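/- Let $N\ge 2$, $s\in(0,1)$, $m>0$, $2^*_s=\frac{2N}{N-2s}$, and let $g:\mathbb R\to\mathbb R$ satisfy - (g0) $g$ is continuous and $g(0)=0$; - (g1) $\limsup_{t\to0}\frac{g(t)}{t}\le 0$; - (g2) $\limsup_{|t|\to+\infty}\frac{|g(t)|}{|t|^{2^*_s-1}}<\infty$. Set $G(t)=\int_0^t g(\tau)\,d\tau$ and let $H^s(\mathbb R^N)=\{u\in L^2(\mathbb R^N)\mid |\cdot|^s\mathcal F(u)\in L^2(\mathbb R^N)\}$ (real-valued functions). For $u\in H^s(\mathbb R^N)$ and $\mu\in\mathbb R$ define, with values in $\mathbb R\cup\{+\infty\}$ (where $\int_{\mathbb R^N} G(u)\,dx\in[-\infty,+\infty)$), $$K(u)=\tfrac12\int_{\mathbb R^N}|(-\Delta)^{s/2}u|^2dx-\int_{\mathbb R^N}G(u)\,dx,\qquad J_\mu(u)=K(u)+\tfrac{\mu}{2}\int_{\mathbb R^N}u^2dx,$$ $$P_\mu(u)=\int_{\mathbb R^N}|(-\Delta)^{s/2}u|^2dx+2^*_s\int_{\mathbb R^N}\Big(\tfrac{\mu}{2}u^2-G(u)\Big)dx,$$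 and let $$\mathcal S_m=\Big\{u\in H^s(\mathbb R^N)\;\Big|\;\int_{\mathbb R^N}u^2dx=m\Big\},\qquad \mathcal P_\mu=\{u\in H^s(\mathbb R^N)\setminus\{0\}\mid P_\mu(u)=0\}.$$ An $L^2$-minimum is a function $u\in\mathcal S_m$ with $K(u)=\inf_{\mathcal S_m}K$; it has Lagrange multiplier $\mu\in\mathbb R$ if $u$ is a weak solution of $(-\Delta)^su+\mu u=g(u)$ in $\mathbb R^N$, i.e. $$\int_{\mathbb R^N}(-\Delta)^{s/2}u\,(-\Delta)^{s/2}\varphi\,dx+\mu\int_{\mathbb R^N}u\varphi\,dx=\int_{\mathbb R^N}g(u)\varphi\,dx\qquad\text{for all }\varphi\in H^s(\mathbb R^N)\cap L^1(\mathbb R^N).$$ Then the following hold. (i) If $u$ is an $L^2$-minimum with Lagrange multiplier $\mu\in\mathbb R$, then $u\in\mathcal P_\mu$, $J_\mu(u)=\inf_{\mathcal P_\mu}J_\mu$, and $$\inf_{\mathcal S_m}K=\inf_{\mathcal P_\mu}J_\mu-\frac{\mu}{2}m.$$ (ii) Let $\mu\in\mathbb R$ be the Lagrange multiplier of some $L^2$-minimum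 $v\in\mathcal S_m$. If $u\in\mathcal P_\mu$ satisfies $J_\mu(u)=\inf_{\mathcal P_\mu}J_\mu$, then $u\in\mathcal S_m$ and $K(u)=\inf_{\mathcal S_m}K$. -/

import Mathlib

open MeasureTheory Filter Topology
open scoped ENNReal FourierTransform

noncomputable section

namespace FracNLS

/-- The Euclidean space `ℝ^N`. -/
abbrev RN (N : ℕ) : Type := EuclideanSpace ℝ (Fin N)

/-- The real space `L²(ℝ^N)`. -/
abbrev L2 (N : ℕ) : Type := Lp ℝ 2 (volume : Measure (RN N))

/-- The complex space `L²(ℝ^N; ℂ)`. -/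
abbrev L2C (N : ℕ) : Type := Lp ℂ 2 (volume : Measure (RN N))

/-- A real `L²` function regarded as a complex one. -/
def complexify (N : ℕ) : L2 N →L[ℝ] L2C N :=
  Complex.ofRealCLM.compLpL 2 (volume : Measure (RN N))

/-- The function `ξ ↦ |ξ|^s 𝓕(u)(ξ)`. As `𝓕` is normalised with kernel `exp(-2πi⟨x, ξ⟩)`,
the frequency variable is `2πξ`, so that the symbol of `(-Δ)^(s/2)` is `(2π|ξ|)^s`. -/
def symbolMul {N : ℕ} (s : ℝ) (u : L2 N) : RN N → ℂ :=
  fun ξ => ((2 * Real.pi * ‖ξ‖) ^ s : ℝ) • (𝓕 (complexify N u) : L2C N) ξ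

lemma symbolMul_add {N : ℕ} (s : ℝ) (u v : L2 N) :
    symbolMul s (u + v) =ᵐ[volume] symbolMul s u + symbolMul s v := by
  have h : (𝓕 (complexify N (u + v)) : L2C N) = 𝓕 (complexify N u) + 𝓕 (complexify N v) := by
    rw [map_add, FourierTransform.fourier_add]
  filter_upwards [Lp.coeFn_add (𝓕 (complexify N u) : L2C N) (𝓕 (complexify N v))] with ξ hξ
  simp only [symbolMul, Pi.add_apply, h, hξ, smul_add]

lemma symbolMul_smul {N : ℕ} (s c : ℝ) (u : L2 N) :
    symbolMul s (c • u) =ᵐ[volume] c • symbolMul s u := by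
  have h : (𝓕 (complexify N (c • u)) : L2C N) = (c : ℂ) • 𝓕 (complexify N u) := by
    rw [map_smul, ← FourierTransform.fourier_smul]
    congr 1
  filter_upwards [Lp.coeFn_smul (c : ℂ) (𝓕 (complexify N u) : L2C N)] with ξ hξ
  simp only [symbolMul, Pi.smul_apply, h, hξ, Complex.real_smul, smul_eq_mul]
  ring

lemma symbolMul_zero {N : ℕ} (s : ℝ) : symbolMul s (0 : L2 N) =ᵐ[volume] 0 := by
  simpa using symbolMul_smul s 0 (0 : L2 N)

/-- The fractional Sobolev space `H^s(ℝ^N)` of real-valued functions: all `u ∈ L²(ℝ^N)` such that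
`|·|^s 𝓕(u) ∈ L²(ℝ^N)`. -/
def Hs (N : ℕ) (s : ℝ) : Submodule ℝ (L2 N) where
  carrier := {u | MemLp (symbolMul s u) 2 volume}
  add_mem' := fun {u v} hu hv => (memLp_congr_ae (symbolMul_add s u v)).2 (hu.add hv)
  zero_mem' := (memLp_congr_ae (symbolMul_zero s)).2 MemLp.zero
  smul_mem' := fun c u hu => (memLp_congr_ae (symbolMul_smul s c u)).2 (hu.const_smul c)

variable {N : ℕ} {s : ℝ}

/-- `(-Δ)^(s/2) u = 𝓕⁻¹(|ξ|^s 𝓕(u))`, as an element of `L²`. -/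
def halfLap (u : Hs N s) : L2C N := 𝓕⁻ (MemLp.toLp (symbolMul s (u : L2 N)) u.2)

/-- The Dirichlet energy `∫ |(-Δ)^(s/2) u|² dx`. -/
def energy (u : Hs N s) : ℝ := ∫ x, ‖halfLap u x‖ ^ 2

/-- The form `∫ (-Δ)^(s/2) u (-Δ)^(s/2) φ dx`. Both factors are real-valued for real `u` and `φ`;
conjugating one of them and taking the real part only reflects that they are elements
of the complex `L²`. -/
def energyForm (u φ : Hs N s) : ℝ :=
  ∫ x, (halfLap u x * (starRingEnd ℂ) (halfLap φ x)).re

/-- The mass `|u|₂² = ∫ u² dx`. -/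
def mass (u : Hs N s) : ℝ := ∫ x, ((u : L2 N) x) ^ 2

/-- The integral `∫ f dx ∈ [-∞, +∞]`: the integral of the positive part minus the integral of the
negative part. (If both are infinite, the value is `⊥` by convention; for `f = G(u)` with
`u ∈ H^s` and `g` as below, the integral of the positive part is always finite.) -/
def extIntegral (f : RN N → ℝ) : EReal :=
  ((∫⁻ x, ENNReal.ofReal (f x) : ℝ≥0∞) : EReal) - ((∫⁻ x, ENNReal.ofReal (-f x) : ℝ≥0∞) : EReal)

/-- The primitive `G(t) = ∫₀ᵗ g(τ) dτ`. -/
def primitive (g : ℝ → ℝ) (t : ℝ) : ℝ := ∫ τ in (0 : ℝ)..t, g τ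

/-- `∫ G(u) dx ∈ [-∞, +∞]`. -/
def potential (g : ℝ → ℝ) (u : Hs N s) : EReal :=
  extIntegral (fun x => primitive g ((u : L2 N) x))

/-- The fractional critical Sobolev exponent `2^*_s = 2N / (N - 2s)`. -/
def critExp (N : ℕ) (s : ℝ) : ℝ := 2 * N / (N - 2 * s)

/-- The assumptions on the nonlinearity: `g` is continuous and `g(0) = 0`;
`limsup_{t → 0} g(t)/t ≤ 0`; `limsup_{|t| → ∞} |g(t)| / |t|^(2^*_s - 1) < ∞`. -/
structure IsAdmissible (N : ℕ) (s : ℝ) (g : ℝ → ℝ) : Prop where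
  continuous : Continuous g
  map_zero : g 0 = 0
  limsup_zero : limsup (fun t : ℝ => ((g t / t : ℝ) : EReal)) (𝓝[≠] 0) ≤ 0
  limsup_infty :
    limsup (fun t : ℝ => ((|g t| / |t| ^ (critExp N s - 1) : ℝ) : EReal)) (atBot ⊔ atTop) < ⊤

/-- The energy functional `K(u) = ½ ∫ |(-Δ)^(s/2) u|² - ∫ G(u)`. -/
def K (g : ℝ → ℝ) (u : Hs N s) : EReal :=
  ((1 / 2 * energy u : ℝ) : EReal) - potential g u

/-- The action functional `J_μ(u) = ½ ∫ |(-Δ)^(s/2) u|² + μ/2 ∫ u² - ∫ G(u)`. -/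
def J (g : ℝ → ℝ) (μ : ℝ) (u : Hs N s) : EReal :=
  ((1 / 2 * energy u + μ / 2 * mass u : ℝ) : EReal) - potential g u

/-- The Pohožaev functional `P_μ(u) = ∫ |(-Δ)^(s/2) u|² + 2^*_s (μ/2 ∫ u² - ∫ G(u))`. -/
def P (g : ℝ → ℝ) (μ : ℝ) (u : Hs N s) : EReal :=
  ((energy u : ℝ) : EReal)
    + ((critExp N s : ℝ) : EReal) * (((μ / 2 * mass u : ℝ) : EReal) - potential g u)

/-- The Pohožaev set `𝓟_μ`. -/
def pohozaevSet (N : ℕ) (s : ℝ) (g : ℝ → ℝ) (μ : ℝ) : Set (Hs N s) :=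
  {u | u ≠ 0 ∧ P g μ u = 0}

/-- The `L²`-sphere `𝓢_m`. -/
def sphere (N : ℕ) (s m : ℝ) : Set (Hs N s) := {u | mass u = m}

/-- `u` is a weak solution of `(-Δ)^s u + μ u = g(u)` in `ℝ^N`, tested against all
`φ ∈ H^s ∩ L¹`. -/
def IsWeakSolution (g : ℝ → ℝ) (μ : ℝ) (u : Hs N s) : Prop :=
  ∀ φ : Hs N s, Integrable ((φ : L2 N) : RN N → ℝ) volume →
    energyForm u φ + μ * ∫ x, (u : L2 N) x * (φ : L2 N) x
      = ∫ x, g ((u : L2 N) x) * (φ : L2 N) x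

/-- `u` is an `L²`-minimum: `u ∈ 𝓢_m` and `K(u) = inf_{𝓢_m} K`. -/
def IsL2Min (g : ℝ → ℝ) (m : ℝ) (u : Hs N s) : Prop :=
  u ∈ sphere N s m ∧ K g u = ⨅ v ∈ sphere N s m, K g v

/-- `u` is an `L²`-minimum with Lagrange multiplier `μ`. -/
def IsL2MinWithMultiplier (g : ℝ → ℝ) (m μ : ℝ) (u : Hs N s) : Prop :=
  IsL2Min g m u ∧ IsWeakSolution g μ u

/-- `u` minimizes `J_μ` on the Pohožaev set: `u ∈ 𝓟_μ` and `J_μ(u) = inf_{𝓟_μ} J_μ`. -/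
def IsActionMin (g : ℝ → ℝ) (μ : ℝ) (u : Hs N s) : Prop :=
  u ∈ pohozaevSet N s g μ ∧ J g μ u = ⨅ v ∈ pohozaevSet N s g μ, J g μ v

end FracNLS

end

open FracNLS

/-!
A dilation `u(c ·)` brings the mass of any `w ≠ 0` to the value `m`. With `r = m / mass w` and
`α = 2 / 2*_s`, an `L²`-minimum `u` therefore satisfies
`K(u) ≤ ½ r ^ α ‖(-Δ)^{s/2} w‖² - r ∫ G(w)` for every `w ≠ 0`.
For `w = u + t φ` with `∫ u φ ≠ 0`, criticality at `t = 0` combined with the weak equation is the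
Pohožaev identity. For `w ∈ 𝓟_μ`, it reads
`J_μ(u) ≤ ½ ‖(-Δ)^{s/2} w‖² (r ^ α - α r) ≤ ½ (1 - α) ‖(-Δ)^{s/2} w‖² = J_μ(w)`
by Bernoulli's inequality, which is strict unless `r = 1`.
The Sobolev embedding `H^s ⊂ L^{2*_s}`, obtained by splitting the frequencies at a radius depending
on the level, makes the potential finite and differentiable along bounded integrable directions.
-/

noncomputable section

namespace FracNLS

variable {N : ℕ} {s : ℝ}

section Dilation

open Module

variable {E F : Type*} [NormedAddCommGroup E] [NormedSpace ℝ E] [FiniteDimensional ℝ E]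
  [MeasurableSpace E] [BorelSpace E] {μ : Measure E} [μ.IsAddHaarMeasure]
  [NormedAddCommGroup F] {p : ℝ≥0∞}

lemma quasiMeasurePreserving_units_smul (c : ℝˣ) :
    Measure.QuasiMeasurePreserving (fun x : E => c • x) μ μ := by
  refine ⟨measurable_const_smul c, ?_⟩
  rw [show (fun x : E => c • x) = ((c : ℝ) • ·) from rfl, Measure.map_addHaar_smul μ c.ne_zero]
  exact Measure.smul_absolutelyContinuous

lemma eLpNorm_comp_units_smul {f : E → F} (c : ℝˣ) (hf : AEStronglyMeasurable f μ) :
    eLpNorm (fun x => f (c • x)) p μ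
      = ENNReal.ofReal |((c : ℝ) ^ finrank ℝ E)⁻¹| ^ (1 / p).toReal * eLpNorm f p μ := by
  have hmap : Measure.map (fun x : E => c • x) μ
      = ENNReal.ofReal |((c : ℝ) ^ finrank ℝ E)⁻¹| • μ :=
    Measure.map_addHaar_smul μ c.ne_zero
  have hpos : ENNReal.ofReal |((c : ℝ) ^ finrank ℝ E)⁻¹| ≠ 0 := by simp
  rw [← smul_eq_mul, ← eLpNorm_smul_measure_of_ne_zero hpos, ← hmap,
    eLpNorm_map_measure (by rw [hmap]; exact hf.mono_ac Measure.smul_absolutelyContinuous)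
      (measurable_const_smul c).aemeasurable]
  rfl

lemma memLp_comp_units_smul {f : E → F} (c : ℝˣ) (hf : MemLp f p μ) :
    MemLp (fun x => f (c • x)) p μ := by
  refine ⟨hf.1.comp_quasiMeasurePreserving (quasiMeasurePreserving_units_smul c), ?_⟩
  rw [eLpNorm_comp_units_smul c hf.1]
  exact ENNReal.mul_lt_top (ENNReal.rpow_lt_top_of_nonneg (by positivity) (by simp)) hf.2

lemma norm_toLp_comp_units_smul (c : ℝˣ) (f : Lp F p μ) :
    ‖(memLp_comp_units_smul c (Lp.memLp f)).toLp‖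
      = |((c : ℝ) ^ finrank ℝ E)⁻¹| ^ (1 / p).toReal * ‖f‖ := by
  rw [Lp.norm_toLp, eLpNorm_comp_units_smul c (Lp.aestronglyMeasurable f), ENNReal.toReal_mul,
    ← ENNReal.toReal_rpow, ENNReal.toReal_ofReal (abs_nonneg _), Lp.norm_def]

variable [NormedSpace ℝ F] [Fact (1 ≤ p)]

/-- The dilation `f ↦ f(c ·)` on `Lᵖ`. The scale is a unit, so that `c⁻¹` is again a scale. -/
def dilate (c : ℝˣ) : Lp F p μ →L[ℝ] Lp F p μ :=
  LinearMap.mkContinuous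
    { toFun := fun f => (memLp_comp_units_smul c (Lp.memLp f)).toLp
      map_add' := fun f g => by
        rw [← MemLp.toLp_add]
        exact MemLp.toLp_congr _ _
          ((quasiMeasurePreserving_units_smul c).ae_eq_comp (Lp.coeFn_add f g))
      map_smul' := fun a f => by
        rw [RingHom.id_apply, ← MemLp.toLp_const_smul]
        exact MemLp.toLp_congr _ _
          ((quasiMeasurePreserving_units_smul c).ae_eq_comp (Lp.coeFn_smul a f)) }
    (|((c : ℝ) ^ finrank ℝ E)⁻¹| ^ (1 / p).toReal)
    fun f => (norm_toLp_comp_units_smul c f).le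

lemma coeFn_dilate (c : ℝˣ) (f : Lp F p μ) : dilate c f =ᵐ[μ] fun x => f (c • x) :=
  MemLp.coeFn_toLp (memLp_comp_units_smul c (Lp.memLp f))

lemma dilate_toLp (c : ℝˣ) {f : E → F} (hf : MemLp f p μ) :
    dilate c hf.toLp = (memLp_comp_units_smul c hf).toLp :=
  MemLp.toLp_congr (memLp_comp_units_smul c (Lp.memLp _)) _
    ((quasiMeasurePreserving_units_smul c).ae_eq_comp hf.coeFn_toLp)

lemma norm_sq_dilate (c : ℝˣ) (f : Lp F 2 μ) :
    ‖dilate c f‖ ^ 2 = |((c : ℝ) ^ finrank ℝ E)⁻¹| * ‖f‖ ^ 2 := by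
  have h : ‖dilate c f‖ = |((c : ℝ) ^ finrank ℝ E)⁻¹| ^ (1 / 2 : ℝ≥0∞).toReal * ‖f‖ :=
    norm_toLp_comp_units_smul c f
  rw [h, mul_pow, ← Real.rpow_natCast, ← Real.rpow_mul (abs_nonneg _)]
  simp

end Dilation

section FourierDilation

open Module

variable {V H : Type*} [NormedAddCommGroup V] [InnerProductSpace ℝ V] [FiniteDimensional ℝ V]
  [MeasurableSpace V] [BorelSpace V]

lemma fourier_comp_units_smul [NormedAddCommGroup H] [NormedSpace ℂ H] (f : V → H) (c : ℝˣ)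
    (ξ : V) :
    𝓕 (fun x => f (c • x)) ξ = |((c : ℝ) ^ finrank ℝ V)⁻¹| • 𝓕 f (c⁻¹ • ξ) := by
  rw [Real.fourier_eq, Real.fourier_eq, ← Measure.integral_comp_smul volume
    (fun v => Real.fourierChar (-(inner ℝ v (c⁻¹ • ξ))) • f v) (c : ℝ)]
  refine integral_congr_ae (.of_forall fun v => ?_)
  simp [Units.smul_def, inner_smul_left, inner_smul_right]

lemma dilate_schwartz [NormedAddCommGroup H] [NormedSpace ℝ H] (c : ℝˣ) (φ : SchwartzMap V H) :
    dilate c (φ.toLp 2 (volume : Measure V))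
      = (SchwartzMap.compCLMOfContinuousLinearEquiv ℝ
          (ContinuousLinearEquiv.smulLeft c : V ≃L[ℝ] V) φ).toLp 2 := by
  refine Lp.ext ?_
  filter_upwards [coeFn_dilate c (φ.toLp 2 (volume : Measure V)),
    (SchwartzMap.compCLMOfContinuousLinearEquiv ℝ
      (ContinuousLinearEquiv.smulLeft c : V ≃L[ℝ] V) φ).coeFn_toLp 2 (volume : Measure V),
    (quasiMeasurePreserving_units_smul c).ae_eq_comp
      (φ.coeFn_toLp 2 (volume : Measure V))] with x h_dil h_comp hφ
  rw [h_dil, h_comp]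
  exact hφ

variable [NormedAddCommGroup H] [InnerProductSpace ℂ H] [CompleteSpace H]

lemma fourier_dilate (c : ℝˣ) (f : Lp H 2 (volume : Measure V)) :
    𝓕 (dilate c f) = |((c : ℝ) ^ finrank ℝ V)⁻¹| • dilate c⁻¹ (𝓕 f) := by
  refine DenseRange.induction_on (SchwartzMap.denseRange_toLpCLM (p := 2)
    ENNReal.ofNat_ne_top) f (isClosed_eq ?_ ?_) fun φ => ?_
  · exact (Lp.fourierTransformₗᵢ V H).continuous.comp (dilate c).continuous
  · exact (|((c : ℝ) ^ finrank ℝ V)⁻¹| • dilate c⁻¹).continuous.comp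
      (Lp.fourierTransformₗᵢ V H).continuous
  · rw [SchwartzMap.toLpCLM_apply, dilate_schwartz, SchwartzMap.toLp_fourier_eq,
      SchwartzMap.toLp_fourier_eq, dilate_schwartz, ← SchwartzMap.toLpCLM_apply (𝕜 := ℝ),
      ← SchwartzMap.toLpCLM_apply (𝕜 := ℝ), ← map_smul]
    congr 1
    ext ξ
    rw [SchwartzMap.fourier_coe]
    exact fourier_comp_units_smul φ c ξ

end FourierDilation

section SobolevSpace

lemma norm_sq_eq_integral_norm_sq {α F : Type*} [MeasurableSpace α] {μ : Measure α}
    [NormedAddCommGroup F] (f : Lp F 2 μ) : ‖f‖ ^ 2 = ∫ x, ‖f x‖ ^ 2 ∂μ := by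
  rw [Lp.norm_def, (Lp.memLp f).eLpNorm_eq_integral_rpow_norm two_ne_zero ENNReal.ofNat_ne_top,
    ENNReal.toReal_ofReal (by positivity), ← Real.rpow_natCast, ← Real.rpow_mul (by positivity)]
  simp

lemma energy_eq_norm_sq (u : Hs N s) : energy u = ‖halfLap u‖ ^ 2 :=
  (norm_sq_eq_integral_norm_sq _).symm

lemma mass_eq_norm_sq (u : Hs N s) : mass u = ‖(u : L2 N)‖ ^ 2 := by
  simp only [norm_sq_eq_integral_norm_sq, mass, Real.norm_eq_abs, sq_abs]

lemma energyForm_eq_re_inner (u φ : Hs N s) :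
    energyForm u φ = RCLike.re (inner ℂ (halfLap u) (halfLap φ)) := by
  rw [inner_re_symm, L2.inner_def, ← integral_re (L2.integrable_inner _ _)]
  rfl

lemma memLp_symbolMul (u : Hs N s) : MemLp (symbolMul s (u : L2 N)) 2 volume := u.2

lemma fourier_halfLap (u : Hs N s) : 𝓕 (halfLap u) = (memLp_symbolMul u).toLp :=
  FourierTransform.fourier_fourierInv_eq _

lemma halfLap_add (u v : Hs N s) : halfLap (u + v) = halfLap u + halfLap v := by
  refine (Lp.fourierTransformₗᵢ (RN N) ℂ).injective ?_
  rw [map_add]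
  change 𝓕 (halfLap (u + v)) = 𝓕 (halfLap u) + 𝓕 (halfLap v)
  rw [fourier_halfLap, fourier_halfLap, fourier_halfLap, ← MemLp.toLp_add]
  exact MemLp.toLp_congr _ _ (symbolMul_add s (u : L2 N) v)

lemma fourier_real_smul (t : ℝ) (f : L2C N) : 𝓕 (t • f) = t • 𝓕 f :=
  (Lp.fourierTransformₗᵢ (RN N) ℂ).toLinearEquiv.toLinearMap.map_smul_of_tower t f

lemma halfLap_smul (t : ℝ) (u : Hs N s) : halfLap (t • u) = t • halfLap u := by
  refine (Lp.fourierTransformₗᵢ (RN N) ℂ).injective ?_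
  change 𝓕 (halfLap (t • u)) = 𝓕 (t • halfLap u)
  rw [fourier_real_smul, fourier_halfLap, fourier_halfLap, ← MemLp.toLp_const_smul]
  exact MemLp.toLp_congr _ _ (symbolMul_smul s t (u : L2 N))

lemma energy_add_smul (u φ : Hs N s) (t : ℝ) :
    energy (u + t • φ) = energy u + 2 * t * energyForm u φ + t ^ 2 * energy φ := by
  rw [energy_eq_norm_sq, energy_eq_norm_sq, energy_eq_norm_sq, halfLap_add, halfLap_smul,
    energyForm_eq_re_inner, @norm_add_sq ℂ, norm_smul, mul_pow, Real.norm_eq_abs, sq_abs,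
    RCLike.real_smul_eq_coe_smul (K := ℂ), inner_smul_right, RCLike.re_ofReal_mul]
  ring

lemma mass_add_smul (u φ : Hs N s) (t : ℝ) :
    mass (u + t • φ) = mass u + 2 * t * (∫ x, (u : L2 N) x * (φ : L2 N) x) + t ^ 2 * mass φ := by
  have h_inner : inner ℝ (u : L2 N) (φ : L2 N) = ∫ x, (u : L2 N) x * (φ : L2 N) x := by
    simp only [L2.inner_def, RCLike.inner_apply', conj_trivial]
  rw [mass_eq_norm_sq, mass_eq_norm_sq, mass_eq_norm_sq, Submodule.coe_add, Submodule.coe_smul,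
    norm_add_sq_real, inner_smul_right, h_inner, norm_smul, mul_pow, Real.norm_eq_abs, sq_abs]
  ring

lemma mass_pos {u : Hs N s} (hu : u ≠ 0) : 0 < mass u := by
  have : (u : L2 N) ≠ 0 := by simpa using hu
  rw [mass_eq_norm_sq]
  positivity

lemma coeFn_complexify (u : L2 N) : complexify N u =ᵐ[volume] fun x => (u x : ℂ) :=
  ContinuousLinearMap.coeFn_compLpL _ _

lemma complexify_injective : Function.Injective (complexify N) := by
  intro u v h
  refine Lp.ext ?_
  filter_upwards [coeFn_complexify u, coeFn_complexify v] with x hu hv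
  rw [h, hv] at hu
  exact_mod_cast hu.symm

lemma halfLap_ne_zero [NeZero N] {u : Hs N s} (hu : u ≠ 0) : halfLap u ≠ 0 := by
  contrapose! hu
  have h_symbol : symbolMul s (u : L2 N) =ᵐ[volume] 0 := by
    rw [← MemLp.toLp_eq_toLp_iff (memLp_symbolMul u) MemLp.zero, ← fourier_halfLap, hu,
      MemLp.toLp_zero]
    exact map_zero (Lp.fourierTransformₗᵢ (RN N) ℂ)
  have h_fourier : (𝓕 (complexify N (u : L2 N)) : L2C N) = 0 := by
    refine Lp.ext ?_
    filter_upwards [h_symbol, Lp.coeFn_zero ℂ 2 (volume : Measure (RN N)),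
      Measure.ae_ne volume (0 : RN N)] with ξ hξ h_zero hξ0
    have : 0 < (2 * Real.pi * ‖ξ‖) ^ s := by
      have := norm_pos_iff.2 hξ0
      positivity
    rw [h_zero]
    simpa [symbolMul, this.ne'] using hξ
  have h_complexify : complexify N (u : L2 N) = 0 :=
    (Lp.fourierTransformₗᵢ (RN N) ℂ).map_eq_zero_iff.1 h_fourier
  exact Subtype.ext (complexify_injective (by rw [h_complexify, ZeroMemClass.coe_zero, map_zero]))

lemma energy_pos [NeZero N] {u : Hs N s} (hu : u ≠ 0) : 0 < energy u := by
  rw [energy_eq_norm_sq]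
  have := halfLap_ne_zero hu
  positivity

lemma complexify_dilate (c : ℝˣ) (u : L2 N) :
    complexify N (dilate c u) = dilate c (complexify N u) := by
  refine Lp.ext ?_
  filter_upwards [coeFn_complexify (dilate c u), coeFn_dilate c u,
    coeFn_dilate c (complexify N u),
    (quasiMeasurePreserving_units_smul c).ae_eq_comp (coeFn_complexify u)] with x h₁ h₂ h₃ h₄
  rw [h₁, h₂, h₃]
  exact h₄.symm

lemma symbolMul_dilate (c : ℝˣ) (u : L2 N) :
    symbolMul s (dilate c u) =ᵐ[volume]
      fun ξ => (|(c : ℝ)| ^ s * |((c : ℝ) ^ N)⁻¹|) • symbolMul s u (c⁻¹ • ξ) := by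
  have h_fourier := fourier_dilate c (complexify N u)
  rw [finrank_euclideanSpace_fin, ← complexify_dilate] at h_fourier
  filter_upwards [Lp.coeFn_smul |((c : ℝ) ^ N)⁻¹| (dilate c⁻¹ (𝓕 (complexify N u))),
    coeFn_dilate c⁻¹ (𝓕 (complexify N u))] with ξ h_smul h_dilate
  have h_norm : 2 * Real.pi * ‖ξ‖ = |(c : ℝ)| * (2 * Real.pi * ‖c⁻¹ • ξ‖) := by
    rw [Units.smul_def, norm_smul, Units.val_inv_eq_inv_val, norm_inv, Real.norm_eq_abs]
    field_simp [abs_ne_zero.2 c.ne_zero]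
  rw [symbolMul, h_fourier, h_smul, Pi.smul_apply, h_dilate, symbolMul, smul_smul, smul_smul,
    h_norm, Real.mul_rpow (abs_nonneg _) (by positivity)]
  congr 1
  ring

/-- The dilation `u ↦ u(c ·)` on `H^s`. -/
def dil (c : ℝˣ) (u : Hs N s) : Hs N s :=
  ⟨dilate c u, (memLp_congr_ae (symbolMul_dilate c (u : L2 N))).2
    ((memLp_comp_units_smul c⁻¹ (memLp_symbolMul u)).const_smul
      (|(c : ℝ)| ^ s * |((c : ℝ) ^ N)⁻¹|))⟩

lemma coeFn_dil (c : ℝˣ) (u : Hs N s) :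
    (dil c u : L2 N) =ᵐ[volume] fun x => (u : L2 N) (c • x) :=
  coeFn_dilate c (u : L2 N)

lemma halfLap_dil (c : ℝˣ) (u : Hs N s) :
    halfLap (dil c u) = |(c : ℝ)| ^ s • dilate c (halfLap u) := by
  refine (Lp.fourierTransformₗᵢ (RN N) ℂ).injective ?_
  change 𝓕 (halfLap (dil c u)) = 𝓕 (|(c : ℝ)| ^ s • dilate c (halfLap u))
  rw [fourier_real_smul, fourier_dilate, fourier_halfLap, fourier_halfLap, dilate_toLp,
    finrank_euclideanSpace_fin, smul_smul, ← MemLp.toLp_const_smul]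
  exact MemLp.toLp_congr _ _ (symbolMul_dilate c (u : L2 N))

lemma energy_dil (c : ℝˣ) (u : Hs N s) :
    energy (dil c u) = |(c : ℝ)| ^ (2 * s - N) * energy u := by
  have hc : 0 < |(c : ℝ)| := abs_pos.2 c.ne_zero
  rw [energy_eq_norm_sq, energy_eq_norm_sq, halfLap_dil, norm_smul, mul_pow, norm_sq_dilate,
    finrank_euclideanSpace_fin, ← mul_assoc, abs_inv, abs_pow, Real.rpow_sub hc,
    Real.rpow_natCast, mul_comm 2 s, Real.rpow_mul hc.le, Real.rpow_two,
    Real.norm_of_nonneg (by positivity), div_eq_mul_inv]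

lemma mass_dil (c : ℝˣ) (u : Hs N s) : mass (dil c u) = |((c : ℝ) ^ N)⁻¹| * mass u := by
  have h : ‖(dil c u : L2 N)‖ ^ 2 = |((c : ℝ) ^ Module.finrank ℝ (RN N))⁻¹| * ‖(u : L2 N)‖ ^ 2 :=
    norm_sq_dilate c (u : L2 N)
  rwa [finrank_euclideanSpace_fin, ← mass_eq_norm_sq, ← mass_eq_norm_sq] at h

end SobolevSpace

section TestFunctions

lemma rpow_le_one_add_sq_pow {r : ℝ} (hr : 0 ≤ r) {n : ℕ} (hn : s ≤ n) (hs : 0 ≤ s) :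
    r ^ s ≤ (1 + r ^ 2) ^ n :=
  calc r ^ s ≤ (1 + r ^ 2) ^ s := by
        gcongr
        nlinarith [sq_nonneg (r - 1)]
    _ ≤ (1 + r ^ 2) ^ (n : ℝ) := by
        gcongr
        nlinarith
    _ = (1 + r ^ 2) ^ n := Real.rpow_natCast _ _

lemma memLp_rpow_smul_schwartz (hs : 0 ≤ s) (ψ : SchwartzMap (RN N) ℂ) :
    MemLp (fun ξ : RN N => ((2 * Real.pi * ‖ξ‖) ^ s : ℝ) • ψ ξ) 2 volume := by
  obtain ⟨n, hn⟩ := exists_nat_ge s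
  have h_growth : (fun ξ : RN N => (1 + (2 * Real.pi) ^ 2 * ‖ξ‖ ^ 2) ^ n).HasTemperateGrowth := by
    fun_prop
  have h_meas : AEStronglyMeasurable (fun ξ : RN N => ((2 * Real.pi * ‖ξ‖) ^ s : ℝ) • ψ ξ) volume :=
    (((continuous_const.mul continuous_norm).rpow_const fun _ => Or.inr hs).smul
      ψ.continuous).aestronglyMeasurable
  have h_mem := (SchwartzMap.smulLeftCLM ℂ
    (fun ξ : RN N => (1 + (2 * Real.pi) ^ 2 * ‖ξ‖ ^ 2) ^ n) ψ).memLp 2 volume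
  refine h_mem.mono h_meas (.of_forall fun ξ => ?_)
  rw [SchwartzMap.smulLeftCLM_apply_apply h_growth, norm_smul, norm_smul, ← mul_pow,
    Real.norm_of_nonneg (by positivity), Real.norm_of_nonneg (by positivity)]
  gcongr
  exact rpow_le_one_add_sq_pow (by positivity) hn hs

lemma complexify_schwartz (φ : SchwartzMap (RN N) ℝ) :
    complexify N (φ.toLp 2) = (SchwartzMap.postcompCLM Complex.ofRealCLM φ).toLp 2 := by
  refine Lp.ext ?_
  filter_upwards [coeFn_complexify (φ.toLp 2 : L2 N), φ.coeFn_toLp 2 (volume : Measure (RN N)),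
    (SchwartzMap.postcompCLM Complex.ofRealCLM φ).coeFn_toLp 2 (volume : Measure (RN N))]
    with x h_complexify hφ h_postcomp
  rw [h_complexify, hφ, h_postcomp]
  rfl

/-- A real Schwartz function as an element of `H^s`. -/
def schwartzHs (hs : 0 ≤ s) (φ : SchwartzMap (RN N) ℝ) : Hs N s where
  val := φ.toLp 2
  property := by
    refine (memLp_congr_ae ?_).2
      (memLp_rpow_smul_schwartz hs (𝓕 (SchwartzMap.postcompCLM Complex.ofRealCLM φ)))
    filter_upwards [(𝓕 (SchwartzMap.postcompCLM Complex.ofRealCLM φ)).coeFn_toLp 2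
      (volume : Measure (RN N))] with ξ hξ
    rw [symbolMul, complexify_schwartz, SchwartzMap.toLp_fourier_eq, hξ]

lemma coeFn_schwartzHs (hs : 0 ≤ s) (φ : SchwartzMap (RN N) ℝ) :
    (schwartzHs hs φ : L2 N) =ᵐ[volume] φ :=
  φ.coeFn_toLp 2 (volume : Measure (RN N))

lemma exists_schwartz_integral_ne_zero {u : L2 N} (hu : u ≠ 0) :
    ∃ φ : SchwartzMap (RN N) ℝ, ∫ x, u x * φ x ≠ 0 := by
  contrapose! hu
  have h_loc : LocallyIntegrable u volume := (Lp.memLp u).locallyIntegrable (by norm_num)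
  refine (Lp.eq_zero_iff_ae_eq_zero).2 ?_
  exact ae_eq_zero_of_integral_contDiff_smul_eq_zero h_loc fun φ hφ h_supp => by
    simpa [mul_comm] using hu (h_supp.toSchwartzMap hφ)

/-- The admissible directions of variation: bounded integrable elements of `H^s`. -/
structure IsTestFunction (φ : Hs N s) : Prop where
  integrable : Integrable (φ : L2 N) volume
  bounded : ∃ M, ∀ᵐ x, |(φ : L2 N) x| ≤ M

lemma isTestFunction_schwartzHs (hs : 0 ≤ s) (φ : SchwartzMap (RN N) ℝ) :
    IsTestFunction (schwartzHs hs φ) := by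
  refine ⟨φ.integrable.congr (coeFn_schwartzHs hs φ).symm,
    ‖φ.toBoundedContinuousFunction‖, ?_⟩
  filter_upwards [coeFn_schwartzHs hs φ] with x hx
  rw [hx]
  exact φ.toBoundedContinuousFunction.norm_coe_le_norm x

lemma exists_isTestFunction_integral_mul_ne_zero (hs : 0 ≤ s) {u : Hs N s} (hu : u ≠ 0) :
    ∃ φ : Hs N s, IsTestFunction φ ∧ ∫ x, (u : L2 N) x * (φ : L2 N) x ≠ 0 := by
  obtain ⟨φ, hφ⟩ := exists_schwartz_integral_ne_zero (u := (u : L2 N)) (by simpa using hu)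
  refine ⟨schwartzHs hs φ, isTestFunction_schwartzHs hs φ, ?_⟩
  rwa [integral_congr_ae
    ((coeFn_schwartzHs hs φ).mono fun x hx => congrArg ((u : L2 N) x * ·) hx)]

end TestFunctions

section FourierInv

variable {V H : Type*} [NormedAddCommGroup V] [InnerProductSpace ℝ V] [FiniteDimensional ℝ V]
  [MeasurableSpace V] [BorelSpace V] [NormedAddCommGroup H]

lemma norm_fourierInv_le_integral_norm [NormedSpace ℂ H] (w : V → H) (x : V) :
    ‖𝓕⁻ w x‖ ≤ ∫ ξ, ‖w ξ‖ := by
  rw [Real.fourierInv_eq_fourier_neg]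
  exact VectorFourier.norm_fourierIntegral_le_integral_norm _ _ _ _ _

lemma continuous_fourierInv_of_integrable [NormedSpace ℂ H] {w : V → H} (hw : Integrable w) :
    Continuous (𝓕⁻ w) := by
  rw [← Real.Lp.fourierTransformInv_toLp (memLp_one_iff_integrable.2 hw)]
  exact BoundedContinuousFunction.continuous _

lemma integral_fourierInv_smul [NormedSpace ℂ H] [CompleteSpace H] {w : V → H} (hw : Integrable w)
    (φ : SchwartzMap V ℂ) :
    ∫ ξ, 𝓕⁻ φ ξ • w ξ = ∫ x, φ x • 𝓕⁻ w x := calc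
  ∫ ξ, 𝓕⁻ φ ξ • w ξ = ∫ ξ, 𝓕 (φ : V → ℂ) ξ • w (-ξ) := by
    rw [← integral_neg_eq_self]
    simp only [SchwartzMap.fourierInv_coe, Real.fourierInv_eq_fourier_neg, neg_neg]
  _ = ∫ x, φ x • 𝓕 (fun ξ => w (-ξ)) x := by
    have h := VectorFourier.integral_fourierIntegral_smul_eq_flip (L := innerₗ V) (μ := volume)
      (ν := volume) Real.continuous_fourierChar continuous_inner φ.integrable hw.comp_neg
    rwa [flip_innerₗ] at h
  _ = ∫ x, φ x • 𝓕⁻ w x := by simp only [Real.fourierInv_eq_fourier_comp_neg]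

variable [InnerProductSpace ℂ H] [CompleteSpace H]

lemma coeFn_fourierInv_of_integrable (w : Lp H 2 (volume : Measure V)) (hw : Integrable w) :
    (𝓕⁻ w : Lp H 2 (volume : Measure V)) =ᵐ[volume] 𝓕⁻ (w : V → H) := by
  refine ae_eq_of_integral_contDiff_smul_eq
    ((Lp.memLp (𝓕⁻ w : Lp H 2 (volume : Measure V))).locallyIntegrable one_le_two)
    (continuous_fourierInv_of_integrable hw).locallyIntegrable fun g hg hc => ?_
  let φ : SchwartzMap V ℂ := SchwartzMap.postcompCLM Complex.ofRealCLM (hc.toSchwartzMap hg)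
  have h_distribution := congrArg (fun T : TemperedDistribution V H => T φ)
    (Lp.fourierInv_toTemperedDistribution_eq w)
  simp only [TemperedDistribution.fourierInv_apply, Lp.toTemperedDistribution_apply]
    at h_distribution
  have h_test : ∫ x, φ x • (𝓕⁻ w : Lp H 2 (volume : Measure V)) x
      = ∫ x, φ x • 𝓕⁻ (w : V → H) x := by
    rw [← integral_fourierInv_smul hw φ, h_distribution]
  exact h_test

lemma enorm_fourierInv (f : Lp H 2 (volume : Measure V)) : ‖𝓕⁻ f‖ₑ = ‖f‖ₑ := by
  rw [← ofReal_norm, ← ofReal_norm]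
  exact congrArg _ ((Lp.fourierTransformₗᵢ V H).symm.norm_map f)

lemma lintegral_enorm_sq {α F : Type*} [MeasurableSpace α] {μ : Measure α}
    [NormedAddCommGroup F] (f : Lp F 2 μ) : ∫⁻ x, ‖f x‖ₑ ^ 2 ∂μ = ‖f‖ₑ ^ 2 := by
  have h := eLpNorm_nnreal_pow_eq_lintegral (μ := μ) (f := f) (p := 2) two_ne_zero
  simpa [Lp.enorm_def] using h.symm

lemma lintegral_enorm_toLp_indicator_pow {α F : Type*} [MeasurableSpace α] {μ : Measure α}
    [NormedAddCommGroup F] {p : ℝ≥0∞} {f : α → F} {S : Set α} (hS : MeasurableSet S)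
    (hf : MemLp (S.indicator f) p μ) {n : ℕ} (hn : n ≠ 0) :
    ∫⁻ x, ‖hf.toLp _ x‖ₑ ^ n ∂μ = ∫⁻ x in S, ‖f x‖ₑ ^ n ∂μ := by
  rw [← lintegral_indicator hS]
  refine lintegral_congr_ae ?_
  filter_upwards [hf.coeFn_toLp] with x hx
  rw [hx]
  by_cases h : x ∈ S <;> simp [h, hn]

lemma measure_lt_norm_fourierInv_add_le (f h : Lp H 2 (volume : Measure V)) {a b : ℝ}
    (ha : 0 ≤ a) (hf : ∫⁻ ξ, ‖f ξ‖ₑ ≤ ENNReal.ofReal a) :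
    volume {x | a + b < ‖(𝓕⁻ (f + h) : Lp H 2 (volume : Measure V)) x‖}
      ≤ volume {x | ENNReal.ofReal b ≤ ‖(𝓕⁻ h : Lp H 2 (volume : Measure V)) x‖ₑ} := by
  have hf_int : Integrable f := ⟨Lp.aestronglyMeasurable f, hf.trans_lt ENNReal.ofReal_lt_top⟩
  have hf_norm : ∫ ξ, ‖f ξ‖ ≤ a := by
    rw [integral_norm_eq_lintegral_enorm hf_int.1]
    exact ENNReal.toReal_le_of_le_ofReal ha hf
  refine measure_mono_ae ?_
  filter_upwards [coeFn_fourierInv_of_integrable f hf_int,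
    Lp.coeFn_add (𝓕⁻ f : Lp H 2 (volume : Measure V)) (𝓕⁻ h)] with x hx_f hx_add
  intro (hx : a + b < ‖(𝓕⁻ (f + h) : Lp H 2 (volume : Measure V)) x‖)
  change ENNReal.ofReal b ≤ _
  rw [FourierTransform.fourierInv_add, hx_add, Pi.add_apply, hx_f] at hx
  rw [← ofReal_norm]
  refine ENNReal.ofReal_le_ofReal ?_
  linarith [norm_fourierInv_le_integral_norm f x, norm_add_le (𝓕⁻ (f : V → H) x)
    ((𝓕⁻ h : Lp H 2 (volume : Measure V)) x)]

/-- Chebyshev's inequality for the frequencies outside `S`, those in `S` contributing at most half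
of the level. -/
lemma measure_lt_norm_fourierInv_le (F : Lp H 2 (volume : Measure V)) {S : Set V}
    (hS : MeasurableSet S) {t : ℝ} (ht : 0 < t)
    (hFS : ∫⁻ ξ in S, ‖F ξ‖ₑ ≤ ENNReal.ofReal (t / 2)) :
    volume {x | t < ‖(𝓕⁻ F : Lp H 2 (volume : Measure V)) x‖}
      ≤ ENNReal.ofReal (4 * t ^ (-2 : ℝ)) * ∫⁻ ξ in Sᶜ, ‖F ξ‖ₑ ^ 2 := by
  have h_low : MemLp (S.indicator F) 2 volume := (Lp.memLp F).indicator hS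
  have h_high : MemLp (Sᶜ.indicator F) 2 volume := (Lp.memLp F).indicator hS.compl
  have h_split : F = h_low.toLp + h_high.toLp := by
    rw [← MemLp.toLp_add]
    refine Lp.ext ?_
    filter_upwards [(h_low.add h_high).coeFn_toLp] with x hx
    rw [hx, Set.indicator_self_add_compl]
  have h_low_le : ∫⁻ ξ, ‖h_low.toLp _ ξ‖ₑ ≤ ENNReal.ofReal (t / 2) := by
    simpa only [pow_one] using (lintegral_enorm_toLp_indicator_pow hS h_low one_ne_zero).trans_le
      (by simpa only [pow_one] using hFS)
  have h_const : (ENNReal.ofReal (t / 2))⁻¹ ^ 2 = ENNReal.ofReal (4 * t ^ (-2 : ℝ)) := by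
    rw [← ENNReal.ofReal_inv_of_pos (by positivity), ← ENNReal.ofReal_pow (by positivity),
      Real.rpow_neg ht.le, Real.rpow_two]
    congr 1
    field_simp
    norm_num
  have h_chebyshev := meas_ge_le_mul_pow_eLpNorm_enorm volume two_ne_zero ENNReal.ofNat_ne_top
    (Lp.aestronglyMeasurable (𝓕⁻ (h_high.toLp) : Lp H 2 (volume : Measure V)))
    (ε := ENNReal.ofReal (t / 2)) (by simpa using ht) (by simp)
  rw [← Lp.enorm_def, enorm_fourierInv, ENNReal.toReal_ofNat, ENNReal.rpow_two, ENNReal.rpow_two,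
    ← lintegral_enorm_sq, lintegral_enorm_toLp_indicator_pow hS.compl h_high two_ne_zero,
    h_const] at h_chebyshev
  have h_add := measure_lt_norm_fourierInv_add_le (b := t / 2) _ (h_high.toLp) (by positivity)
    h_low_le
  rw [← h_split, add_halves] at h_add
  exact h_add.trans h_chebyshev

end FourierInv

section SobolevEmbedding

open Module Metric

section LowFrequencies

variable {E H : Type*} [NormedAddCommGroup E] [NormedSpace ℝ E] [FiniteDimensional ℝ E]
  [MeasurableSpace E] [BorelSpace E] {μ : Measure E} [μ.IsAddHaarMeasure] [NormedAddCommGroup H]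

lemma setIntegral_ball_rpow_norm {A : ℝ} (hA : 0 < A) (r : ℝ) :
    ∫ ξ in ball (0 : E) A, ‖ξ‖ ^ r ∂μ
      = A ^ (finrank ℝ E + r) * ∫ ξ in ball (0 : E) 1, ‖ξ‖ ^ r ∂μ := by
  have h := Measure.setIntegral_comp_smul_of_pos μ (fun ξ : E => ‖ξ‖ ^ r) (ball 0 1) hA
  simp only [norm_smul, Real.norm_of_nonneg hA.le, Real.mul_rpow hA.le (norm_nonneg _),
    integral_const_mul, smul_unitBall_of_pos hA, smul_eq_mul] at h
  rw [Real.rpow_add hA, Real.rpow_natCast, mul_assoc, h, mul_inv_cancel_left₀ (by positivity)]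

lemma setLIntegral_enorm_le_weighted [Nontrivial E] {F : E → H}
    (hF : AEStronglyMeasurable F μ) (S : Set E) (s : ℝ) :
    ∫⁻ ξ in S, ‖F ξ‖ₑ ∂μ ≤ (∫⁻ ξ in S, ENNReal.ofReal (‖ξ‖ ^ (-(2 * s))) ∂μ) ^ (1 / 2 : ℝ)
      * (∫⁻ ξ, ‖F ξ‖ₑ ^ 2 * ENNReal.ofReal (‖ξ‖ ^ (2 * s)) ∂μ) ^ (1 / 2 : ℝ) := by
  have h_sq (r : ℝ) (ξ : E) :
      ENNReal.ofReal (‖ξ‖ ^ r) ^ (2 : ℝ) = ENNReal.ofReal (‖ξ‖ ^ (2 * r)) := by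
    rw [ENNReal.ofReal_rpow_of_nonneg (by positivity) zero_le_two, ← Real.rpow_mul (norm_nonneg _),
      mul_comm r]
  calc ∫⁻ ξ in S, ‖F ξ‖ₑ ∂μ
      = ∫⁻ ξ in S, ENNReal.ofReal (‖ξ‖ ^ (-s)) * (‖F ξ‖ₑ * ENNReal.ofReal (‖ξ‖ ^ s)) ∂μ := by
        refine lintegral_congr_ae (ae_restrict_of_ae ?_)
        filter_upwards [Measure.ae_ne μ (0 : E)] with ξ hξ
        rw [mul_left_comm, ← ENNReal.ofReal_mul (by positivity),
          ← Real.rpow_add (norm_pos_iff.2 hξ)]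
        simp
    _ ≤ (∫⁻ ξ in S, ENNReal.ofReal (‖ξ‖ ^ (-s)) ^ (2 : ℝ) ∂μ) ^ (1 / 2 : ℝ)
          * (∫⁻ ξ in S, (‖F ξ‖ₑ * ENNReal.ofReal (‖ξ‖ ^ s)) ^ (2 : ℝ) ∂μ) ^ (1 / 2 : ℝ) :=
        ENNReal.lintegral_mul_le_Lp_mul_Lq _ Real.HolderConjugate.two_two (by fun_prop)
          (hF.enorm.restrict.mul (by fun_prop))
    _ ≤ _ := by
        simp only [ENNReal.mul_rpow_of_nonneg _ _ zero_le_two, h_sq, ENNReal.rpow_two,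
          mul_neg]
        gcongr
        exact Measure.restrict_le_self

/-- The bound on the low frequencies in the Sobolev embedding. -/
lemma exists_setLIntegral_ball_enorm_le [Nontrivial E] {s : ℝ} (hs : 2 * s < finrank ℝ E)
    {F : E → H} (hF : AEStronglyMeasurable F μ)
    (h_fin : ∫⁻ ξ, ‖F ξ‖ₑ ^ 2 * ENNReal.ofReal (‖ξ‖ ^ (2 * s)) ∂μ ≠ ∞) :
    ∃ C : ℝ, 0 < C ∧ ∀ A : ℝ, 0 < A →
      ∫⁻ ξ in ball 0 A, ‖F ξ‖ₑ ∂μ ≤ ENNReal.ofReal (C * A ^ (finrank ℝ E / 2 - s)) := by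
  set κ : ℝ := ∫ ξ in ball (0 : E) 1, ‖ξ‖ ^ (-(2 * s)) ∂μ
  obtain ⟨M, hM, h_eq⟩ : ∃ M : ℝ, 0 ≤ M ∧
      ∫⁻ ξ, ‖F ξ‖ₑ ^ 2 * ENNReal.ofReal (‖ξ‖ ^ (2 * s)) ∂μ = ENNReal.ofReal M :=
    ⟨_, ENNReal.toReal_nonneg, (ENNReal.ofReal_toReal h_fin).symm⟩
  have hκ : 0 ≤ κ := integral_nonneg fun _ => by positivity
  refine ⟨κ ^ (1 / 2 : ℝ) * M ^ (1 / 2 : ℝ) + 1, by positivity, fun A hA => ?_⟩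
  have h_weight : ∫⁻ ξ in ball (0 : E) A, ENNReal.ofReal (‖ξ‖ ^ (-(2 * s))) ∂μ
      = ENNReal.ofReal (A ^ (finrank ℝ E - 2 * s) * κ) := by
    rw [sub_eq_add_neg, ← setIntegral_ball_rpow_norm hA, ofReal_integral_eq_lintegral_ofReal
      (integrableOn_ball_of_norm_le_rpow (C := 1) finrank_pos hs ?_
        (by fun_prop : Measurable fun ξ : E => ‖ξ‖ ^ (-(2 * s))).aestronglyMeasurable)
      (ae_of_all _ fun _ => by positivity)]
    exact ae_of_all _ fun ξ => by rw [one_mul, Real.norm_of_nonneg (by positivity)]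
  refine (setLIntegral_enorm_le_weighted hF _ s).trans ?_
  rw [h_weight, h_eq, ENNReal.ofReal_rpow_of_nonneg (by positivity) (by norm_num),
    ENNReal.ofReal_rpow_of_nonneg (by positivity) (by norm_num),
    ← ENNReal.ofReal_mul (by positivity), Real.mul_rpow (by positivity) hκ, ← Real.rpow_mul hA.le,
    show (finrank ℝ E - 2 * s) * (1 / 2) = finrank ℝ E / 2 - s by ring]
  refine ENNReal.ofReal_le_ofReal ?_
  nlinarith [Real.rpow_pos_of_pos hA (finrank ℝ E / 2 - s)]

end LowFrequencies

lemma lintegral_rpow_le_of_measure_lt_le {α β : Type*} [MeasurableSpace α] [MeasurableSpace β]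
    {μ : Measure α} {ν : Measure β} {f : α → ℝ} {Φ : β → ℝ} (hf : AEMeasurable f μ)
    (hf_nonneg : 0 ≤ᵐ[μ] f) (hΦ : AEMeasurable Φ ν) (hΦ_nonneg : 0 ≤ᵐ[ν] Φ) {c p r : ℝ}
    (hc : 0 ≤ c) (hp : 0 < p) (hr : r < p)
    (h : ∀ t, 0 < t → μ {x | t < f x} ≤ ENNReal.ofReal (c * t ^ (-r)) * ν {y | t ≤ Φ y}) :
    ∫⁻ x, ENNReal.ofReal (f x ^ p) ∂μ
      ≤ ENNReal.ofReal (c * p / (p - r)) * ∫⁻ y, ENNReal.ofReal (Φ y ^ (p - r)) ∂ν := by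
  have hpr : 0 < p - r := sub_pos.2 hr
  rw [lintegral_rpow_eq_lintegral_meas_lt_mul μ hf_nonneg hf hp,
    lintegral_rpow_eq_lintegral_meas_le_mul ν hΦ_nonneg hΦ hpr, ← mul_assoc,
    ← ENNReal.ofReal_mul (by positivity), div_mul_cancel₀ _ hpr.ne', mul_comm c,
    ENNReal.ofReal_mul hp.le, mul_assoc,
    ← lintegral_const_mul' (ENNReal.ofReal c) _ ENNReal.ofReal_ne_top]
  refine mul_le_mul' le_rfl (setLIntegral_mono' measurableSet_Ioi fun t (ht : 0 < t) => ?_)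
  calc μ {x | t < f x} * ENNReal.ofReal (t ^ (p - 1))
      ≤ ENNReal.ofReal (c * t ^ (-r)) * ν {y | t ≤ Φ y} * ENNReal.ofReal (t ^ (p - 1)) := by
        gcongr
        exact h t ht
    _ = ENNReal.ofReal c * (ν {y | t ≤ Φ y} * ENNReal.ofReal (t ^ (p - r - 1))) := by
        rw [mul_right_comm, ← ENNReal.ofReal_mul (by positivity), mul_assoc c,
          ← Real.rpow_add ht, ENNReal.ofReal_mul hc, mul_assoc, mul_comm (ν _)]
        congr 4
        ring

lemma lintegral_rpow_norm_fourierInv_lt_top {V H : Type*} [NormedAddCommGroup V]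
    [InnerProductSpace ℝ V] [FiniteDimensional ℝ V] [MeasurableSpace V] [BorelSpace V]
    [Nontrivial V] [NormedAddCommGroup H] [InnerProductSpace ℂ H] [CompleteSpace H]
    {s p : ℝ} (hs : 2 * s < finrank ℝ V) (hp : 2 < p)
    (hsp : (finrank ℝ V / 2 - s) * (p - 2) = 2 * s)
    (F : Lp H 2 (volume : Measure V))
    (h_fin : ∫⁻ ξ, ‖F ξ‖ₑ ^ 2 * ENNReal.ofReal (‖ξ‖ ^ (2 * s)) ≠ ∞) :
    ∫⁻ x, ENNReal.ofReal (‖(𝓕⁻ F : Lp H 2 (volume : Measure V)) x‖ ^ p) < ∞ := by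
  set β : ℝ := finrank ℝ V / 2 - s with hβ_def
  have hβ : 0 < β := by rw [hβ_def]; linarith
  obtain ⟨C, hC, h_low⟩ := exists_setLIntegral_ball_enorm_le hs (Lp.aestronglyMeasurable F) h_fin
  set ν : Measure V := volume.withDensity (fun ξ => ‖F ξ‖ₑ ^ 2)
  -- At level `t` split the frequencies at the radius where the bound on the low ones is `t / 2`.
  have h_dist (t : ℝ) (ht : 0 < t) : volume {x | t < ‖(𝓕⁻ F : Lp H 2 (volume : Measure V)) x‖}
      ≤ ENNReal.ofReal (4 * t ^ (-2 : ℝ)) * ν {ξ | t ≤ 2 * C * ‖ξ‖ ^ β} := by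
    have h_ball : (ball (0 : V) ((t / (2 * C)) ^ β⁻¹))ᶜ = {ξ | t ≤ 2 * C * ‖ξ‖ ^ β} := by
      ext ξ
      rw [Set.mem_compl_iff, mem_ball_zero_iff, not_lt, Set.mem_ofPred_eq,
        Real.rpow_inv_le_iff_of_pos (by positivity) (norm_nonneg _) hβ,
        div_le_iff₀' (by positivity)]
    rw [← h_ball, withDensity_apply _ measurableSet_ball.compl]
    refine measure_lt_norm_fourierInv_le F measurableSet_ball ht
      ((h_low _ (by positivity)).trans_eq ?_)
    rw [Real.rpow_inv_rpow (by positivity) hβ.ne']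
    congr 1
    field_simp
  refine (lintegral_rpow_le_of_measure_lt_le (Lp.aestronglyMeasurable _).norm.aemeasurable
    (ae_of_all _ fun _ => norm_nonneg _) (by fun_prop) (ae_of_all _ fun _ => by positivity)
    (by norm_num) (by linarith) hp h_dist).trans_lt (ENNReal.mul_lt_top ENNReal.ofReal_lt_top ?_)
  rw [lintegral_withDensity_eq_lintegral_mul₀ ((Lp.aestronglyMeasurable F).enorm.pow_const 2)
    (by fun_prop)]
  simp only [Pi.mul_apply, Real.mul_rpow (show 0 ≤ 2 * C by positivity)
    (Real.rpow_nonneg (norm_nonneg _) β), ← Real.rpow_mul (norm_nonneg _), hsp,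
    ENNReal.ofReal_mul (show 0 ≤ (2 * C) ^ (p - 2) by positivity), mul_left_comm]
  rw [lintegral_const_mul' _ _ ENNReal.ofReal_ne_top]
  exact ENNReal.mul_lt_top ENNReal.ofReal_lt_top h_fin.lt_top

lemma neZero_of_two_mul_lt (hs : 0 < s) (hsN : 2 * s < N) : NeZero N :=
  ⟨by rintro rfl; norm_num at hsN; linarith⟩

lemma two_lt_critExp (hs : 0 < s) (hsN : 2 * s < N) : 2 < critExp N s := by
  rw [critExp, lt_div_iff₀ (by linarith)]
  linarith

lemma lintegral_enorm_sq_fourier_mul_rpow_lt_top (u : Hs N s) :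
    ∫⁻ ξ, ‖(𝓕 (complexify N (u : L2 N)) : L2C N) ξ‖ₑ ^ 2 * ENNReal.ofReal (‖ξ‖ ^ (2 * s)) < ∞ := by
  refine (lintegral_congr fun ξ => ?_).trans_lt
    ((MemLp.integrable_norm_pow (p := 2) (memLp_symbolMul u) two_ne_zero).const_mul
      ((2 * Real.pi) ^ (-(2 * s)))).lintegral_lt_top
  have h_pi : (2 * Real.pi) ^ (-(2 * s)) * (2 * Real.pi) ^ (2 * s) = 1 := by
    rw [← Real.rpow_add (by positivity), neg_add_cancel, Real.rpow_zero]
  rw [symbolMul, norm_smul, mul_pow, Real.norm_of_nonneg (by positivity),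
    ← Real.rpow_mul_natCast (by positivity), Real.mul_rpow (by positivity) (norm_nonneg _),
    Nat.cast_ofNat, mul_comm s, mul_assoc, ← mul_assoc, h_pi, one_mul, mul_comm,
    ENNReal.ofReal_mul (by positivity), ENNReal.ofReal_pow (norm_nonneg _), ofReal_norm]

lemma integrable_rpow_critExp (hs : 0 < s) (hsN : 2 * s < N) (u : Hs N s) :
    Integrable (fun x => |(u : L2 N) x| ^ critExp N s) := by
  have : NeZero N := neZero_of_two_mul_lt hs hsN
  have hsp : ((finrank ℝ (RN N) : ℝ) / 2 - s) * (critExp N s - 2) = 2 * s := by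
    have : (N : ℝ) - 2 * s ≠ 0 := by linarith
    rw [finrank_euclideanSpace_fin, critExp]
    field_simp
    ring
  have h := lintegral_rpow_norm_fourierInv_lt_top (by simpa using hsN) (two_lt_critExp hs hsN) hsp
    _ (lintegral_enorm_sq_fourier_mul_rpow_lt_top u).ne
  rw [FourierTransform.fourierInv_fourier_eq] at h
  have h_meas : Measurable (fun x => |(u : L2 N) x| ^ critExp N s) :=
    (Lp.stronglyMeasurable (u : L2 N)).measurable.abs.pow_const _
  refine ⟨h_meas.aestronglyMeasurable,
    (hasFiniteIntegral_iff_ofReal (ae_of_all _ fun _ => by positivity)).2 ?_⟩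
  refine (lintegral_congr_ae ?_).trans_lt h
  filter_upwards [coeFn_complexify (u : L2 N)] with x hx
  rw [hx, Complex.norm_real, Real.norm_eq_abs]

end SobolevEmbedding

variable {g : ℝ → ℝ}

section Growth

lemma IsAdmissible.exists_abs_le (hg : IsAdmissible N s g) :
    ∃ C, 0 ≤ C ∧ ∀ t, |g t| ≤ C * (1 + |t| ^ (critExp N s - 1)) := by
  obtain ⟨M, hM, -⟩ := EReal.lt_iff_exists_real_btwn.1 hg.limsup_infty
  have hev := eventually_lt_of_limsup_lt hM
  rw [← cocompact_eq_atBot_atTop] at hev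
  obtain ⟨S, hS, hfar⟩ := (hasBasis_cocompact.eventually_iff).1 hev
  obtain ⟨D, hD⟩ := hS.exists_bound_of_continuousOn hg.continuous.continuousOn
  refine ⟨|D| + |M|, by positivity, fun t => ?_⟩
  have hpow : 0 ≤ |t| ^ (critExp N s - 1) := by positivity
  by_cases ht : t ∈ S
  · calc |g t| ≤ |D| := (hD t ht).trans (le_abs_self D)
      _ ≤ (|D| + |M|) * (1 + |t| ^ (critExp N s - 1)) := by
        nlinarith [mul_nonneg (abs_nonneg D) hpow, mul_nonneg (abs_nonneg M) hpow, abs_nonneg M]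
  rcases eq_or_ne t 0 with rfl | ht0
  · rw [hg.map_zero, abs_zero]
    positivity
  have hlt : |g t| / |t| ^ (critExp N s - 1) < M := by exact_mod_cast hfar ht
  rw [div_lt_iff₀ (Real.rpow_pos_of_pos (abs_pos.2 ht0) _)] at hlt
  calc |g t| ≤ |M| * |t| ^ (critExp N s - 1) :=
        hlt.le.trans (mul_le_mul_of_nonneg_right (le_abs_self M) hpow)
    _ ≤ (|D| + |M|) * (1 + |t| ^ (critExp N s - 1)) := by
      nlinarith [mul_nonneg (abs_nonneg D) hpow, abs_nonneg D, abs_nonneg M]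

lemma rpow_sub_one_le_one_add_rpow {p x : ℝ} (hp : 1 ≤ p) (hx : 0 ≤ x) :
    x ^ (p - 1) ≤ 1 + x ^ p := by
  rcases le_total x 1 with hx1 | hx1
  · linarith [Real.rpow_le_one hx hx1 (sub_nonneg.2 hp), Real.rpow_nonneg hx p]
  · linarith [Real.rpow_le_rpow_of_exponent_le hx1 (sub_le_self p zero_le_one)]

lemma IsAdmissible.exists_abs_add_le (hg : IsAdmissible N s g) (hp : 1 ≤ critExp N s) (M : ℝ) :
    ∃ D, 0 ≤ D ∧ ∀ a b, |b| ≤ M → |g (a + b)| ≤ D * (1 + |a| ^ critExp N s) := by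
  obtain ⟨C, hC, hgrowth⟩ := hg.exists_abs_le
  set p := critExp N s
  refine ⟨C * (2 + 2 ^ (p - 1) * (1 + |M| ^ p)), by positivity, fun a b hb => ?_⟩
  have hconv : |a + b| ^ p ≤ 2 ^ (p - 1) * (|a| ^ p + |M| ^ p) := by
    refine (Real.rpow_le_rpow (abs_nonneg _) ((abs_add_le a b).trans
      (add_le_add_right (hb.trans (le_abs_self M)) _)) (by linarith)).trans ?_
    exact_mod_cast NNReal.rpow_add_le_mul_rpow_add_rpow (Real.nnabs a) (Real.nnabs M) hp
  have hpow : 0 ≤ |a| ^ p := by positivity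
  have hpowM : 0 ≤ (2 : ℝ) ^ (p - 1) := by positivity
  have hM : 0 ≤ 2 ^ (p - 1) * |M| ^ p := by positivity
  calc |g (a + b)| ≤ C * (1 + |a + b| ^ (p - 1)) := hgrowth _
    _ ≤ C * (2 + 2 ^ (p - 1) * (|a| ^ p + |M| ^ p)) := by
      refine mul_le_mul_of_nonneg_left ?_ hC
      linarith [rpow_sub_one_le_one_add_rpow hp (abs_nonneg (a + b))]
    _ ≤ C * ((2 + 2 ^ (p - 1) * (1 + |M| ^ p)) * (1 + |a| ^ p)) := by
      gcongr
      nlinarith [mul_nonneg hM hpow]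
    _ = C * (2 + 2 ^ (p - 1) * (1 + |M| ^ p)) * (1 + |a| ^ p) := by ring

lemma primitive_sub (hg : Continuous g) (a b : ℝ) :
    primitive g b - primitive g a = ∫ τ in a..b, g τ :=
  intervalIntegral.integral_interval_sub_left (hg.intervalIntegrable _ _)
    (hg.intervalIntegrable _ _)

lemma hasDerivAt_primitive (hg : Continuous g) (t : ℝ) : HasDerivAt (primitive g) (g t) t :=
  (hg.integral_hasStrictDerivAt 0 t).hasDerivAt

lemma continuous_primitive (hg : Continuous g) : Continuous (primitive g) :=
  continuous_iff_continuousAt.2 fun t => (hasDerivAt_primitive hg t).continuousAt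

lemma IsAdmissible.exists_abs_primitive_sub_le (hg : IsAdmissible N s g)
    (hp : 1 ≤ critExp N s) (M : ℝ) : ∃ D, 0 ≤ D ∧ ∀ a b, |b| ≤ M →
      |primitive g (a + b) - primitive g a| ≤ D * (1 + |a| ^ critExp N s) * |b| := by
  obtain ⟨D, hD, hshift⟩ := hg.exists_abs_add_le hp M
  refine ⟨D, hD, fun a b hb => ?_⟩
  have hbound : ∀ τ ∈ Set.uIoc a (a + b), ‖g τ‖ ≤ D * (1 + |a| ^ critExp N s) := fun τ hτ => by
    have hτa : |τ - a| ≤ |b| := by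
      simpa using Set.abs_sub_left_of_mem_uIcc (Set.uIoc_subset_uIcc hτ)
    simpa using hshift a (τ - a) (hτa.trans hb)
  simpa [primitive_sub hg.continuous] using
    intervalIntegral.norm_integral_le_of_norm_le_const hbound

lemma IsAdmissible.eventually_mul_self_le (hg : IsAdmissible N s g) :
    ∀ᶠ t in 𝓝 0, g t * t ≤ t ^ 2 := by
  have hlt : limsup (fun t : ℝ => ((g t / t : ℝ) : EReal)) (𝓝[≠] 0) < ((1 : ℝ) : EReal) :=
    hg.limsup_zero.trans_lt (by exact_mod_cast zero_lt_one)
  have hev := eventually_lt_of_limsup_lt hlt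
  rw [eventually_nhdsWithin_iff] at hev
  filter_upwards [hev] with t ht
  rcases eq_or_ne t 0 with rfl | ht0
  · simp
  have hratio : g t / t ≤ 1 := by exact_mod_cast (ht ht0).le
  calc g t * t = g t / t * t ^ 2 := by field_simp
    _ ≤ t ^ 2 := mul_le_of_le_one_left (sq_nonneg t) hratio

lemma IsAdmissible.exists_mul_self_le (hg : IsAdmissible N s g) :
    ∃ C, 0 ≤ C ∧ ∀ t, g t * t ≤ C * (t ^ 2 + |t| ^ critExp N s) := by
  obtain ⟨C, hC, hgrowth⟩ := hg.exists_abs_le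
  obtain ⟨δ, hδ, hnear⟩ := Metric.eventually_nhds_iff.1 hg.eventually_mul_self_le
  refine ⟨1 + C * (1 + δ⁻¹), by positivity, fun t => ?_⟩
  have hpow : 0 ≤ |t| ^ critExp N s := by positivity
  have hC' : 0 ≤ C * (1 + δ⁻¹) := by positivity
  rcases lt_or_ge |t| δ with ht | ht
  · nlinarith [hnear (y := t) (by simpa using ht), mul_nonneg hC' hpow,
      mul_nonneg hC' (sq_nonneg t)]
  have hinv : |t| ≤ δ⁻¹ * t ^ 2 := by
    rw [inv_mul_eq_div, le_div_iff₀ hδ, ← sq_abs, sq]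
    exact mul_le_mul_of_nonneg_left ht (abs_nonneg t)
  have hrpow : |t| ^ (critExp N s - 1) * |t| = |t| ^ critExp N s := by
    rw [← Real.rpow_add_one (hδ.trans_le ht).ne', sub_add_cancel]
  calc g t * t ≤ |g t| * |t| := (le_abs_self _).trans (abs_mul _ _).le
    _ ≤ C * (1 + |t| ^ (critExp N s - 1)) * |t| :=
      mul_le_mul_of_nonneg_right (hgrowth t) (abs_nonneg t)
    _ = C * (|t| + |t| ^ critExp N s) := by rw [← hrpow]; ring
    _ ≤ C * (δ⁻¹ * t ^ 2 + |t| ^ critExp N s) := by gcongr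
    _ ≤ (1 + C * (1 + δ⁻¹)) * (t ^ 2 + |t| ^ critExp N s) := by
      nlinarith [mul_nonneg hC (sq_nonneg t), mul_nonneg hC (mul_nonneg (inv_pos.2 hδ).le hpow),
        sq_nonneg t]

lemma primitive_eq_integral_unitInterval (t : ℝ) :
    primitive g t = ∫ τ in (0 : ℝ)..1, t * g (τ * t) := by
  rw [intervalIntegral.integral_const_mul, intervalIntegral.mul_integral_comp_mul_right, primitive,
    zero_mul, one_mul]

lemma IsAdmissible.exists_primitive_le (hg : IsAdmissible N s g) (hp : 1 ≤ critExp N s) :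
    ∃ C, 0 ≤ C ∧ ∀ t, primitive g t ≤ C * (t ^ 2 + |t| ^ critExp N s) := by
  obtain ⟨C, hC, hmul⟩ := hg.exists_mul_self_le
  refine ⟨C, hC, fun t => ?_⟩
  have hpoint : ∀ τ ∈ Set.Ioo (0 : ℝ) 1, t * g (τ * t) ≤ C * (t ^ 2 + |t| ^ critExp N s) := by
    rintro τ ⟨hτ0, hτ1⟩
    have hsq : (τ * t) ^ 2 ≤ τ * t ^ 2 := by
      nlinarith [mul_nonneg (mul_nonneg hτ0.le (sub_nonneg.2 hτ1.le)) (sq_nonneg t)]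
    have hpow : |τ * t| ^ critExp N s ≤ τ * |t| ^ critExp N s := by
      rw [abs_mul, Real.mul_rpow (abs_nonneg τ) (abs_nonneg t), abs_of_pos hτ0]
      gcongr
      exact Real.rpow_le_self_of_le_one hτ0.le hτ1.le hp
    refine le_of_mul_le_mul_left ?_ hτ0
    calc τ * (t * g (τ * t)) = g (τ * t) * (τ * t) := by ring
      _ ≤ C * ((τ * t) ^ 2 + |τ * t| ^ critExp N s) := hmul _
      _ ≤ C * (τ * t ^ 2 + τ * |t| ^ critExp N s) := by gcongr
      _ = τ * (C * (t ^ 2 + |t| ^ critExp N s)) := by ring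
  have hcont : Continuous fun τ : ℝ => t * g (τ * t) :=
    continuous_const.mul (hg.continuous.comp (continuous_mul_const t))
  rw [primitive_eq_integral_unitInterval]
  simpa using intervalIntegral.integral_mono_on_of_le_Ioo zero_le_one
    (hcont.intervalIntegrable (μ := volume) _ _) intervalIntegrable_const hpoint

end Growth

section FinitePotential

/-- `u` has finite potential energy `∫ G(u) dx`. -/
def HasFinitePotential (g : ℝ → ℝ) (u : Hs N s) : Prop :=
  Integrable fun x => primitive g ((u : L2 N) x)

/-- The potential energy `∫ G(u) dx` as a real number, with the junk value `0` unless
`HasFinitePotential g u`. -/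
def potentialReal (g : ℝ → ℝ) (u : Hs N s) : ℝ := ∫ x, primitive g ((u : L2 N) x)

lemma extIntegral_eq_coe {f : RN N → ℝ} (hf : Integrable f) :
    extIntegral f = ((∫ x, f x : ℝ) : EReal) := by
  rw [extIntegral, integral_eq_lintegral_pos_part_sub_lintegral_neg_part hf, EReal.coe_sub,
    EReal.coe_ennreal_toReal hf.lintegral_lt_top.ne,
    EReal.coe_ennreal_toReal (show ∫⁻ x, ENNReal.ofReal (-f x) < ∞ from hf.neg.lintegral_lt_top).ne]

lemma integrable_of_extIntegral_ne_bot {f : RN N → ℝ} (hf : AEStronglyMeasurable f)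
    (h_pos : ∫⁻ x, ENNReal.ofReal (f x) < ∞) (h : extIntegral f ≠ ⊥) : Integrable f := by
  have h_neg : ∫⁻ x, ENNReal.ofReal (-f x) < ∞ := by
    refine lt_top_iff_ne_top.2 fun h_top => h ?_
    rw [extIntegral, h_top, EReal.coe_ennreal_top, EReal.sub_top]
  refine ⟨hf, ?_⟩
  calc ∫⁻ x, ‖f x‖ₑ ≤ ∫⁻ x, ENNReal.ofReal (f x) + ENNReal.ofReal (-f x) := by
        refine lintegral_mono fun x => ?_
        rw [Real.enorm_eq_ofReal_abs, abs, ENNReal.ofReal_max]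
        exact max_le_add_of_nonneg zero_le zero_le
    _ = (∫⁻ x, ENNReal.ofReal (f x)) + ∫⁻ x, ENNReal.ofReal (-f x) :=
      lintegral_add_left' hf.aemeasurable.ennreal_ofReal _
    _ < ∞ := ENNReal.add_lt_top.2 ⟨h_pos, h_neg⟩

lemma aestronglyMeasurable_primitive_comp (hg : Continuous g) (u : Hs N s) :
    AEStronglyMeasurable (fun x => primitive g ((u : L2 N) x)) :=
  (continuous_primitive hg).comp_aestronglyMeasurable (Lp.aestronglyMeasurable _)

lemma IsAdmissible.hasFinitePotential_of_ne_bot (hg : IsAdmissible N s g) (hs : 0 < s)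
    (hsN : 2 * s < N) {u : Hs N s} (hu : potential g u ≠ ⊥) : HasFinitePotential g u := by
  obtain ⟨C, -, hC⟩ := hg.exists_primitive_le (one_le_two.trans (two_lt_critExp hs hsN).le)
  have hbound : Integrable fun x =>
      C * (((u : L2 N) x) ^ 2 + |(u : L2 N) x| ^ critExp N s) :=
    ((Lp.memLp (u : L2 N)).integrable_sq.add (integrable_rpow_critExp hs hsN u)).const_mul C
  exact integrable_of_extIntegral_ne_bot (aestronglyMeasurable_primitive_comp hg.continuous u)
    ((lintegral_mono fun x => ENNReal.ofReal_le_ofReal (hC _)).trans_lt hbound.lintegral_lt_top) hu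

lemma IsAdmissible.hasFinitePotential_of_mem_pohozaevSet (hg : IsAdmissible N s g) (hs : 0 < s)
    (hsN : 2 * s < N) {μ : ℝ} {u : Hs N s} (hu : u ∈ pohozaevSet N s g μ) :
    HasFinitePotential g u := by
  refine hg.hasFinitePotential_of_ne_bot hs hsN fun hbot => EReal.top_ne_zero ?_
  rw [← hu.2, P, hbot, EReal.coe_sub_bot,
    EReal.coe_mul_top_of_pos (two_pos.trans (two_lt_critExp hs hsN)), EReal.coe_add_top]

lemma potential_eq_coe {u : Hs N s} (hu : HasFinitePotential g u) :
    potential g u = (potentialReal g u : EReal) :=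
  extIntegral_eq_coe hu

lemma K_eq_coe {u : Hs N s} (hu : HasFinitePotential g u) :
    K g u = ((1 / 2 * energy u - potentialReal g u : ℝ) : EReal) := by
  rw [K, potential_eq_coe hu, EReal.coe_sub]

lemma K_eq_J_sub (μ : ℝ) {m : ℝ} {u : Hs N s} (hu : u ∈ sphere N s m) :
    K g u = J g μ u - ((μ / 2 * m : ℝ) : EReal) := by
  rw [K, J, show mass u = m from hu, sub_eq_add_neg, sub_eq_add_neg, sub_eq_add_neg,
    add_right_comm, ← EReal.coe_neg, ← EReal.coe_add, add_neg_cancel_right]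

lemma P_eq_zero_iff (hp : 0 < critExp N s) {μ : ℝ} {u : Hs N s} (hu : HasFinitePotential g u) :
    P g μ u = 0 ↔ potentialReal g u = μ / 2 * mass u + energy u / critExp N s := by
  rw [P, potential_eq_coe hu, ← EReal.coe_sub, ← EReal.coe_mul, ← EReal.coe_add, EReal.coe_eq_zero]
  field_simp
  constructor <;> intro h <;> linarith

lemma J_eq_of_mem_pohozaevSet (hp : 0 < critExp N s) {μ : ℝ} {u : Hs N s}
    (hu : HasFinitePotential g u) (hP : u ∈ pohozaevSet N s g μ) :
    J g μ u = ((1 / 2 * energy u - energy u / critExp N s : ℝ) : EReal) := by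
  rw [J, potential_eq_coe hu, ← EReal.coe_sub, (P_eq_zero_iff hp hu).1 hP.2]
  congr 1
  ring

lemma HasFinitePotential.dil {u : Hs N s} (hu : HasFinitePotential g u) (c : ℝˣ) :
    HasFinitePotential g (dil c u) :=
  (Integrable.comp_smul hu c.ne_zero).congr
    ((coeFn_dil c u).mono fun _ hx => congrArg (primitive g) hx.symm)

lemma potentialReal_dil (g : ℝ → ℝ) (c : ℝˣ) (u : Hs N s) :
    potentialReal g (dil c u) = |((c : ℝ) ^ N)⁻¹| * potentialReal g u := by
  have h_smul := Measure.integral_comp_smul volume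
    (fun x => primitive g ((u : L2 N) x)) (c : ℝ)
  rw [finrank_euclideanSpace_fin, smul_eq_mul] at h_smul
  rw [potentialReal, potentialReal, ← h_smul]
  exact integral_congr_ae ((coeFn_dil c u).mono fun _ hx => congrArg (primitive g) hx)

end FinitePotential

section Perturbation

lemma coeFn_add_smul (u φ : Hs N s) (t : ℝ) :
    ((u + t • φ : Hs N s) : L2 N) =ᵐ[volume] fun x => (u : L2 N) x + t * (φ : L2 N) x := by
  filter_upwards [Lp.coeFn_add (u : L2 N) (t • (φ : L2 N)), Lp.coeFn_smul t (φ : L2 N)]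
    with x h_add h_smul
  rw [Submodule.coe_add, Submodule.coe_smul, h_add, Pi.add_apply, h_smul, Pi.smul_apply,
    smul_eq_mul]

lemma IsTestFunction.integrable_growth_mul {φ : Hs N s} (hφ : IsTestFunction φ) (hs : 0 < s)
    (hsN : 2 * s < N) (u : Hs N s) (D : ℝ) :
    Integrable fun x => D * (1 + |(u : L2 N) x| ^ critExp N s) * |(φ : L2 N) x| := by
  obtain ⟨M, hM⟩ := hφ.bounded
  have h_mul : Integrable fun x => |(u : L2 N) x| ^ critExp N s * |(φ : L2 N) x| :=
    (integrable_rpow_critExp hs hsN u).mul_bdd (c := M) hφ.integrable.abs.aestronglyMeasurable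
      (hM.mono fun x hx => by simpa using hx)
  simpa only [mul_assoc, add_mul, one_mul, Pi.add_apply] using
    (hφ.integrable.abs.add h_mul).const_mul D

lemma HasFinitePotential.add_smul (hg : IsAdmissible N s g) (hs : 0 < s) (hsN : 2 * s < N)
    {u φ : Hs N s} (hu : HasFinitePotential g u) (hφ : IsTestFunction φ) (t : ℝ) :
    HasFinitePotential g (u + t • φ) := by
  obtain ⟨M, hM⟩ := hφ.bounded
  obtain ⟨D, -, hD⟩ := hg.exists_abs_primitive_sub_le
    (one_le_two.trans (two_lt_critExp hs hsN).le) (|t| * M)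
  have h_diff : Integrable fun x =>
      primitive g (((u + t • φ : Hs N s) : L2 N) x) - primitive g ((u : L2 N) x) := by
    refine ((hφ.integrable_growth_mul hs hsN u D).const_mul |t|).mono'
      ((aestronglyMeasurable_primitive_comp hg.continuous _).sub hu.aestronglyMeasurable) ?_
    filter_upwards [coeFn_add_smul u φ t, hM] with x hx hMx
    have hle := hD ((u : L2 N) x) (t * (φ : L2 N) x)
      ((abs_mul _ _).trans_le (mul_le_mul_of_nonneg_left hMx (abs_nonneg t)))
    rwa [hx, Real.norm_eq_abs, mul_left_comm, ← abs_mul]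
  exact (h_diff.add hu).congr (ae_of_all _ fun x => sub_add_cancel _ _)

lemma IsAdmissible.hasDerivAt_potentialReal (hg : IsAdmissible N s g) (hs : 0 < s)
    (hsN : 2 * s < N) {u φ : Hs N s} (hu : HasFinitePotential g u) (hφ : IsTestFunction φ) :
    HasDerivAt (fun t : ℝ => potentialReal g (u + t • φ))
      (∫ x, g ((u : L2 N) x) * (φ : L2 N) x) 0 := by
  obtain ⟨M, hM⟩ := hφ.bounded
  obtain ⟨D, -, hD⟩ := hg.exists_abs_add_le (one_le_two.trans (two_lt_critExp hs hsN).le) M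
  have h_eq : (fun t : ℝ => potentialReal g (u + t • φ))
      = fun t => ∫ x, primitive g ((u : L2 N) x + t * (φ : L2 N) x) :=
    funext fun t => integral_congr_ae
      ((coeFn_add_smul u φ t).mono fun _ hx => congrArg (primitive g) hx)
  have h_meas (t : ℝ) : AEStronglyMeasurable fun x => (u : L2 N) x + t * (φ : L2 N) x :=
    (Lp.aestronglyMeasurable _).add ((Lp.aestronglyMeasurable _).const_mul t)
  have h_bound : ∀ᵐ x, ∀ t ∈ Metric.ball (0 : ℝ) 1,
      ‖g ((u : L2 N) x + t * (φ : L2 N) x) * (φ : L2 N) x‖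
        ≤ D * (1 + |(u : L2 N) x| ^ critExp N s) * |(φ : L2 N) x| := by
    filter_upwards [hM] with x hMx t ht
    have ht1 : |t| ≤ 1 := by simpa using (Metric.mem_ball.1 ht).le
    rw [norm_mul, Real.norm_eq_abs, Real.norm_eq_abs]
    refine mul_le_mul_of_nonneg_right (hD _ _ ?_) (abs_nonneg _)
    exact (abs_mul _ _).trans_le ((mul_le_of_le_one_left (abs_nonneg _) ht1).trans hMx)
  have h_deriv (x : RN N) (t : ℝ) :
      HasDerivAt (fun t => primitive g ((u : L2 N) x + t * (φ : L2 N) x))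
        (g ((u : L2 N) x + t * (φ : L2 N) x) * (φ : L2 N) x) t := by
    have h_line : HasDerivAt (fun t : ℝ => (u : L2 N) x + t * (φ : L2 N) x) ((φ : L2 N) x) t :=
      (hasDerivAt_mul_const _).const_add _
    exact (hasDerivAt_primitive hg.continuous _).comp t h_line
  rw [h_eq]
  simpa using (hasDerivAt_integral_of_dominated_loc_of_deriv_le
    (Metric.ball_mem_nhds (0 : ℝ) one_pos)
    (Eventually.of_forall fun t =>
      (continuous_primitive hg.continuous).comp_aestronglyMeasurable (h_meas t))
    (by simpa [HasFinitePotential] using hu)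
    ((hg.continuous.comp_aestronglyMeasurable (h_meas 0)).mul (Lp.aestronglyMeasurable _))
    h_bound (hφ.integrable_growth_mul hs hsN u D)
    (ae_of_all _ fun x t _ => h_deriv x t)).2

end Perturbation

section Minimizers

variable {m μ : ℝ}

-- The scale is given by `c ^ N = mass w / m`; note `2 / critExp N s = (N - 2 s) / N`.
lemma exists_dil_mass_eq [NeZero N] (hm : 0 < m) {w : Hs N s} (hw : w ≠ 0) :
    ∃ c : ℝˣ, mass (dil c w) = m ∧
      energy (dil c w) = (m / mass w) ^ (2 / critExp N s) * energy w ∧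
      ∀ g : ℝ → ℝ, potentialReal g (dil c w) = m / mass w * potentialReal g w := by
  have hN : (N : ℝ) ≠ 0 := Nat.cast_ne_zero.2 (NeZero.ne N)
  have hw := mass_pos hw
  have hr : 0 < m / mass w := by positivity
  set b : ℝ := (m / mass w) ^ (-(N : ℝ)⁻¹) with hb
  have hb0 : 0 < b := by positivity
  have hbN : |(b ^ N)⁻¹| = m / mass w := by
    rw [abs_of_pos (by positivity), hb, ← Real.rpow_mul_natCast hr.le, neg_mul,
      inv_mul_cancel₀ hN, Real.rpow_neg_one, inv_inv]
  refine ⟨Units.mk0 b hb0.ne', ?_, ?_, fun g => ?_⟩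
  · rw [mass_dil, Units.val_mk0, hbN, div_mul_cancel₀ m hw.ne']
  · rw [energy_dil, Units.val_mk0, abs_of_pos hb0, hb, ← Real.rpow_mul hr.le, critExp]
    congr 2
    field_simp
    ring
  · rw [potentialReal_dil, Units.val_mk0, hbN]

lemma IsAdmissible.exists_mem_sphere_hasFinitePotential (hg : IsAdmissible N s g) (hs : 0 < s)
    (hsN : 2 * s < N) (hm : 0 < m) {u : Hs N s} (hu : u ≠ 0) :
    ∃ w ∈ sphere N s m, HasFinitePotential g w := by
  have := neZero_of_two_mul_lt hs hsN
  obtain ⟨φ, hφ, h_ne⟩ := exists_isTestFunction_integral_mul_ne_zero hs.le hu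
  have hφ0 : φ ≠ 0 := by
    rintro rfl
    exact h_ne (by simp)
  have h_zero : HasFinitePotential g (0 : Hs N s) := by simp [HasFinitePotential, primitive]
  have h_fin : HasFinitePotential g φ := by simpa using h_zero.add_smul hg hs hsN hφ 1
  obtain ⟨c, hc, -⟩ := exists_dil_mass_eq hm hφ0
  exact ⟨dil c φ, hc, h_fin.dil c⟩

lemma IsL2Min.ne_zero (hm : 0 < m) {u : Hs N s} (hu : IsL2Min g m u) : u ≠ 0 := by
  rintro rfl
  have h_mass : mass (0 : Hs N s) = m := hu.1
  rw [mass_eq_norm_sq] at h_mass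
  simp [hm.ne] at h_mass

lemma IsL2Min.K_le {u w : Hs N s} (hu : IsL2Min g m u) (hw : w ∈ sphere N s m) :
    K g u ≤ K g w :=
  hu.2 ▸ iInf₂_le w hw

lemma IsL2Min.hasFinitePotential (hg : IsAdmissible N s g) (hs : 0 < s) (hsN : 2 * s < N)
    (hm : 0 < m) {u : Hs N s} (hu : IsL2Min g m u) : HasFinitePotential g u := by
  obtain ⟨w, hw, h_fin⟩ := hg.exists_mem_sphere_hasFinitePotential hs hsN hm (hu.ne_zero hm)
  refine hg.hasFinitePotential_of_ne_bot hs hsN fun hbot => ?_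
  have hle := hu.K_le hw
  rw [K_eq_coe h_fin, K, hbot, EReal.coe_sub_bot, top_le_iff] at hle
  exact EReal.coe_ne_top _ hle

lemma IsL2Min.le_rescaled [NeZero N] (hm : 0 < m) {u w : Hs N s} (hu : IsL2Min g m u)
    (hu_fin : HasFinitePotential g u) (hw : w ≠ 0) (hw_fin : HasFinitePotential g w) :
    1 / 2 * energy u - potentialReal g u
      ≤ 1 / 2 * ((m / mass w) ^ (2 / critExp N s) * energy w)
        - m / mass w * potentialReal g w := by
  obtain ⟨c, h_mass, h_energy, h_potential⟩ := exists_dil_mass_eq hm hw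
  have hle := hu.K_le h_mass
  rwa [K_eq_coe hu_fin, K_eq_coe (hw_fin.dil c), EReal.coe_le_coe_iff, h_energy,
    h_potential] at hle

lemma hasDerivAt_quadratic_zero (a b c : ℝ) :
    HasDerivAt (fun t : ℝ => a + 2 * t * b + t ^ 2 * c) (2 * b) 0 := by
  have h_linear := (((hasDerivAt_id (0 : ℝ)).const_mul 2).mul_const b).const_add a
  exact (h_linear.add (((hasDerivAt_id (0 : ℝ)).pow 2).mul_const c)).congr_deriv (by simp)

lemma hasDerivAt_energy_add_smul (u φ : Hs N s) :
    HasDerivAt (fun t : ℝ => energy (u + t • φ)) (2 * energyForm u φ) 0 := by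
  simpa only [energy_add_smul] using hasDerivAt_quadratic_zero _ _ _

lemma hasDerivAt_mass_add_smul (u φ : Hs N s) :
    HasDerivAt (fun t : ℝ => mass (u + t • φ)) (2 * ∫ x, (u : L2 N) x * (φ : L2 N) x) 0 := by
  simpa only [mass_add_smul] using hasDerivAt_quadratic_zero _ _ _

lemma IsL2Min.isLocalMin_rescaled (hg : IsAdmissible N s g) (hs : 0 < s) (hsN : 2 * s < N)
    (hm : 0 < m) {u φ : Hs N s} (hu : IsL2Min g m u) (hφ : IsTestFunction φ) :
    IsLocalMin (fun t : ℝ =>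
      1 / 2 * ((m / mass (u + t • φ)) ^ (2 / critExp N s) * energy (u + t • φ))
        - m / mass (u + t • φ) * potentialReal g (u + t • φ)) 0 := by
  have := neZero_of_two_mul_lt hs hsN
  have hu_fin := hu.hasFinitePotential hg hs hsN hm
  have h_mass : mass u = m := hu.1
  have h_ne : ∀ᶠ t : ℝ in 𝓝 0, mass (u + t • φ) ≠ 0 :=
    (hasDerivAt_mass_add_smul u φ).continuousAt.eventually_ne
      (by rw [zero_smul, add_zero, h_mass]; exact hm.ne')
  filter_upwards [h_ne] with t ht
  have hw : u + t • φ ≠ 0 := fun h => ht (by rw [h, mass_eq_norm_sq]; simp)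
  simpa [h_mass, hm.ne'] using hu.le_rescaled hm hu_fin hw (hu_fin.add_smul hg hs hsN hφ t)

lemma IsL2MinWithMultiplier.mem_pohozaevSet (hg : IsAdmissible N s g) (hs : 0 < s)
    (hsN : 2 * s < N) (hm : 0 < m) {u : Hs N s} (hu : IsL2MinWithMultiplier g m μ u) :
    u ∈ pohozaevSet N s g μ := by
  have hu0 := hu.1.ne_zero hm
  have hu_fin := hu.1.hasFinitePotential hg hs hsN hm
  have h_mass : mass u = m := hu.1.1
  have hp : 0 < critExp N s := two_pos.trans (two_lt_critExp hs hsN)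
  obtain ⟨φ, hφ, h_ne⟩ := exists_isTestFunction_integral_mul_ne_zero hs.le hu0
  have h_weak := hu.2 φ hφ.integrable
  have h_mass_deriv := hasDerivAt_mass_add_smul u φ
  set a := ∫ x, (u : L2 N) x * (φ : L2 N) x
  have h_ratio : HasDerivAt (fun t : ℝ => m / mass (u + t • φ)) (-(2 * a) / m) 0 := by
    have h := (h_mass_deriv.inv (by simp [h_mass, hm.ne'])).const_mul m
    simp only [zero_smul, add_zero, h_mass] at h
    refine h.congr_deriv ?_
    field_simp
  have h_pow := h_ratio.rpow_const (p := 2 / critExp N s) (Or.inl (by simp [h_mass, hm.ne']))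
  have h_deriv := ((h_pow.mul (hasDerivAt_energy_add_smul u φ)).const_mul (1 / 2)).sub
    (h_ratio.mul (hg.hasDerivAt_potentialReal hs hsN hu_fin hφ))
  have h_crit := (hu.1.isLocalMin_rescaled hg hs hsN hm hφ).hasDerivAt_eq_zero h_deriv
  simp only [zero_smul, add_zero, h_mass, div_self hm.ne', Real.one_rpow, mul_one, one_mul]
    at h_crit
  refine ⟨hu0, (P_eq_zero_iff hp hu_fin).2 ?_⟩
  rw [← h_weak] at h_crit
  rw [h_mass]
  field_simp at h_crit ⊢
  refine mul_left_cancel₀ h_ne ?_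
  linear_combination h_crit

lemma IsL2Min.J_le_of_mem_pohozaevSet (hg : IsAdmissible N s g) (hs : 0 < s) (hsN : 2 * s < N)
    (hm : 0 < m) {u v : Hs N s} (hu : IsL2Min g m u) (hv : v ∈ pohozaevSet N s g μ) :
    J g μ u ≤ ((energy v / 2 *
      ((m / mass v) ^ (2 / critExp N s) - 2 / critExp N s * (m / mass v)) : ℝ) : EReal) := by
  have := neZero_of_two_mul_lt hs hsN
  have hp : 0 < critExp N s := two_pos.trans (two_lt_critExp hs hsN)
  have hu_fin := hu.hasFinitePotential hg hs hsN hm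
  have hv_fin := hg.hasFinitePotential_of_mem_pohozaevSet hs hsN hv
  have h_mass : mass u = m := hu.1
  have hle := hu.le_rescaled hm hu_fin hv.1 hv_fin
  rw [(P_eq_zero_iff hp hv_fin).1 hv.2] at hle
  have h_ratio : m / mass v * mass v = m := div_mul_cancel₀ m (mass_pos hv.1).ne'
  rw [J, potential_eq_coe hu_fin, ← EReal.coe_sub, EReal.coe_le_coe_iff, h_mass]
  linear_combination hle - μ / 2 * h_ratio

lemma rpow_sub_mul_le {r α : ℝ} (hr : 0 ≤ r) (hα0 : 0 ≤ α) (hα1 : α ≤ 1) :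
    r ^ α - α * r ≤ 1 - α := by
  have h := rpow_one_add_le_one_add_mul_self (s := r - 1) (by linarith) hα0 hα1
  rw [add_sub_cancel] at h
  linarith

lemma rpow_sub_mul_lt {r α : ℝ} (hr : 0 ≤ r) (hr1 : r ≠ 1) (hα0 : 0 < α) (hα1 : α < 1) :
    r ^ α - α * r < 1 - α := by
  have h := rpow_one_add_lt_one_add_mul_self (s := r - 1) (by linarith) (sub_ne_zero.2 hr1) hα0 hα1
  rw [add_sub_cancel] at h
  linarith

lemma IsL2Min.J_le_J (hg : IsAdmissible N s g) (hs : 0 < s) (hsN : 2 * s < N)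
    (hm : 0 < m) {u v : Hs N s} (hu : IsL2Min g m u) (hv : v ∈ pohozaevSet N s g μ) :
    J g μ u ≤ J g μ v := by
  have := neZero_of_two_mul_lt hs hsN
  have hp := two_lt_critExp hs hsN
  have hE := energy_pos hv.1
  have hr : 0 < m / mass v := div_pos hm (mass_pos hv.1)
  have h_bernoulli := rpow_sub_mul_le hr.le (α := 2 / critExp N s) (by positivity)
    ((div_le_one (by linarith)).2 hp.le)
  refine (hu.J_le_of_mem_pohozaevSet hg hs hsN hm hv).trans ?_
  rw [J_eq_of_mem_pohozaevSet (by linarith) (hg.hasFinitePotential_of_mem_pohozaevSet hs hsN hv) hv,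
    EReal.coe_le_coe_iff]
  linear_combination energy v / 2 * h_bernoulli

lemma IsL2Min.mass_eq_of_J_le (hg : IsAdmissible N s g) (hs : 0 < s) (hsN : 2 * s < N)
    (hm : 0 < m) {u v : Hs N s} (hu : IsL2Min g m u) (hv : v ∈ pohozaevSet N s g μ)
    (hle : J g μ v ≤ J g μ u) : mass v = m := by
  have := neZero_of_two_mul_lt hs hsN
  have hp := two_lt_critExp hs hsN
  by_contra h_ne
  have hr : 0 < m / mass v := div_pos hm (mass_pos hv.1)
  have hr1 : m / mass v ≠ 1 := fun h => h_ne (eq_of_div_eq_one h).symm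
  have h_bernoulli := rpow_sub_mul_lt hr.le hr1 (α := 2 / critExp N s) (by positivity)
    ((div_lt_one (by linarith)).2 hp)
  have h_contra := hle.trans (hu.J_le_of_mem_pohozaevSet hg hs hsN hm hv)
  rw [J_eq_of_mem_pohozaevSet (by linarith) (hg.hasFinitePotential_of_mem_pohozaevSet hs hsN hv) hv,
    EReal.coe_le_coe_iff] at h_contra
  refine (mul_lt_mul_of_pos_left h_bernoulli (half_pos (energy_pos hv.1))).not_ge ?_
  linear_combination h_contra

lemma IsL2MinWithMultiplier.isActionMin (hg : IsAdmissible N s g) (hs : 0 < s)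
    (hsN : 2 * s < N) (hm : 0 < m) {u : Hs N s} (hu : IsL2MinWithMultiplier g m μ u) :
    IsActionMin g μ u :=
  have h_mem := hu.mem_pohozaevSet hg hs hsN hm
  ⟨h_mem, le_antisymm (le_iInf₂ fun _ hv => hu.1.J_le_J hg hs hsN hm hv) (iInf₂_le u h_mem)⟩

lemma IsActionMin.isL2Min (hg : IsAdmissible N s g) (hs : 0 < s) (hsN : 2 * s < N)
    (hm : 0 < m) {u v : Hs N s} (hu : IsActionMin g μ u) (hv : IsL2MinWithMultiplier g m μ v) :
    IsL2Min g m u := by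
  have hJ : J g μ u = J g μ v := hu.2.trans (hv.isActionMin hg hs hsN hm).2.symm
  have h_mass : mass u = m := hv.1.mass_eq_of_J_le hg hs hsN hm hu.1 hJ.le
  refine ⟨h_mass, ?_⟩
  rw [K_eq_J_sub μ h_mass, hJ, ← K_eq_J_sub μ hv.1.1, hv.1.2]

end Minimizers

end FracNLS

end

theorem proposition1p9_general (N : ℕ) (s : ℝ) (hs : 0 < s) (hsN : 2 * s < N)
    (m : ℝ) (hm : 0 < m) (g : ℝ → ℝ) (hg : IsAdmissible N s g) :
    (∀ (μ : ℝ) (u : Hs N s), IsL2MinWithMultiplier g m μ u →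
      IsActionMin g μ u ∧
      (⨅ v ∈ sphere N s m, K g v)
        = (⨅ v ∈ pohozaevSet N s g μ, J g μ v) - ((μ / 2 * m : ℝ) : EReal)) ∧
    (∀ μ : ℝ, (∃ v : Hs N s, IsL2MinWithMultiplier g m μ v) →
      ∀ u : Hs N s, IsActionMin g μ u → u ∈ sphere N s m ∧ IsL2Min g m u) := by
  refine ⟨fun μ u hu => ?_, fun μ ⟨v, hv⟩ u hu => ?_⟩
  · have h_act := hu.isActionMin hg hs hsN hm
    exact ⟨h_act, by rw [← h_act.2, ← hu.1.2, K_eq_J_sub μ hu.1.1]⟩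
  · have h_min := hu.isL2Min hg hs hsN hm hv
    exact ⟨h_min.1, h_min⟩

theorem proposition1p9 (N : ℕ) (hN : 2 ≤ N) (s : ℝ) (hs0 : 0 < s) (hs1 : s < 1)
    (m : ℝ) (hm : 0 < m) (g : ℝ → ℝ) (hg : IsAdmissible N s g) :
    (∀ (μ : ℝ) (u : Hs N s), IsL2MinWithMultiplier g m μ u →
      IsActionMin g μ u ∧
      (⨅ v ∈ sphere N s m, K g v)
        = (⨅ v ∈ pohozaevSet N s g μ, J g μ v) - ((μ / 2 * m : ℝ) : EReal)) ∧
    (∀ μ : ℝ, (∃ v : Hs N s, IsL2MinWithMultiplier g m μ v) →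
      ∀ u : Hs N s, IsActionMin g μ u → u ∈ sphere N s m ∧ IsL2Min g m u) := by
  have h_two : (2 : ℝ) ≤ N := by exact_mod_cast hN
  exact proposition1p9_general N s hs0 (by linarith) m hm g hg
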